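/- Let $1\le\kappa\le d$ be integers, $\|\cdot\|$ the Euclidean norm, and let $p$ be a probability density on $[0,1]^d$ with $p_{\min}\le p(x)\le p_{\max}$ for all $x\in[0,1]^d$, where $0<p_{\min}\le p_{\max}<\infty$. For $\pi:[0,1]^\kappa\to\mathbb R$ a dataset $\mathcal D(\pi)$ is generated as follows: draw $x_1,\dots,x_{n+1}$ i.i.d. from $p$; independently draw a set $S\subset\{1,\dots,d\}$ of $\kappa$ indices uniformly at random; let $\tilde x_i\in[0,1]^\kappa$ be the subvector of $x_i$ with coordinates in $S$ (in increasing order) and $y_i=\pi(\tilde x_i)$. The first $n$ labelled samples are given to the decoder, and $(x_{\mathrm{test}},y_{\mathrm{test}})=(x_{n+1},y_{n+1})$ is the test sample. An ICL decoder is a family, over $n$, of measurable functions $f(\{x_i,y_i\}_{i=1}^n,x_{\mathrm{test}})\in\mathbb R$; it is not told $S$ or $\pi$. (1) For all $1\le\kappa\le d$ there is an ICL decoder $f$, depending only on $d$ and $\kappa$, such that for all $0<p_{\min}\le p_{\max}<\infty$ there is a constant $C$, depending only on $d,\kappa,p_{\min},p_{\max}$, with $$\sup_{\pi}\ \mathbb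 E_{\mathcal D(\pi)\sim p}\Big[y_{\mathrm{test}}-f\big(\{x_i,y_i\}_{i=1}^n,x_{\mathrm{test}}\big)\Big]^2\le C\,L^2\,n^{-2/\kappa}$$ for all such $p$, all $L\ge 0$ and all $n\ge1$, the supremum being over all $L$-Lipschitz $\pi:[0,1]^\kappa\to\mathbb R$. (2) In contrast, let $\kappa=1$ and $y=\tilde x$, fix $d\ge1$ and $L>1$, and let $\mathcal B_L$ be the set of bijections $g:[0,1]^d\to[0,1]^d$ with $L^{-1}\|x-x'\|\le\|g(x)-g(x')\|\le L\|x-x'\|$ for all $x,x'$. For all $0<p_{\min}\le p_{\max}<\infty$ there are constants $0<c\le C$, depending only on $d,L,p_{\min},p_{\max}$, such that for all such $p$ and all $n\ge 1$, with $z=g(x)$, $$c\,n^{-2/d}\le\inf_{f}\ \sup_{g\in\mathcal B_L}\ \mathbb E_{\mathcal D(\pi)\sim p}\Big[y_{\mathrm{test}}-f\big(\{z_i,y_i\}_{i=1}^n,z_{\mathrm{test}}\big)\Big]^2\le C\,n^{-2/d},$$ the infimum being over all measurable $f$ (which may depend on $n$, $L$ and $p$, but not on $g$ or $S$). -/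

import Mathlib

open MeasureTheory
open scoped NNReal ENNReal

noncomputable section

/-- The unit cube `[0,1]^d`; its `volume` is Lebesgue measure. -/
abbrev Cube (d : ℕ) : Type := Fin d → unitInterval

/-- The Euclidean distance on the cube (the default distance on a function type is the
maximum distance, which is not used here). -/
def euclDist {d : ℕ} (x y : Cube d) : ℝ :=
  Real.sqrt (∑ i, ((x i : ℝ) - (y i : ℝ)) ^ 2)

/-- `μ` is a probability distribution on `[0,1]^d` that is absolutely continuous with a density
taking values in `[pmin, pmax]`. -/
def IsInputLaw {d : ℕ} (pmin pmax : ℝ) (μ : Measure (Cube d)) : Prop :=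
  IsProbabilityMeasure μ ∧
    ∃ ρ : Cube d → ℝ, Measurable ρ ∧ (∀ x, pmin ≤ ρ x ∧ ρ x ≤ pmax) ∧
      μ = (volume : Measure (Cube d)).withDensity (fun x => ENNReal.ofReal (ρ x))

/-- The sets of `κ` coordinates out of `d`. -/
abbrev IndexSet (d κ : ℕ) : Type := {S : Finset (Fin d) // S.card = κ}

/-- The reduced feature vector: the coordinates of `x` in `S`, in increasing order. -/
def reduce {d κ : ℕ} (S : IndexSet d κ) (x : Cube d) : Cube κ :=
  fun j => x (S.1.orderEmbOfFin S.2 j)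

/-- An in-context decoder for contexts of length `n`: a (jointly measurable) map that turns `n`
labelled examples and a query point into a prediction. -/
def Decoder (d n : ℕ) : Type :=
  {f : (Fin n → Cube d × ℝ) → Cube d → ℝ //
    Measurable (fun q : (Fin n → Cube d × ℝ) × Cube d => f q.1 q.2)}

/-- The mean squared test error of the decoder `f` with `n` labelled examples, when all inputs
are passed through the encoder `g` before the decoder sees them. The inputs `x 0, …, x n` are
i.i.d. with law `μ`; independently, `S` is a uniformly random set of `κ` coordinates; the labels
are `π (reduce S (x i))`; the last sample is the test sample. The expectation over `S` is
written as the average over all `κ`-subsets. -/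
def iclRisk {d κ n : ℕ} (μ : Measure (Cube d)) (g : Cube d → Cube d) (π : Cube κ → ℝ)
    (f : Decoder d n) : ℝ≥0∞ :=
  (∑ S : IndexSet d κ,
    ∫⁻ x : Fin (n + 1) → Cube d,
      ENNReal.ofReal
        ((π (reduce S (x (Fin.last n)))
          - f.1 (fun i : Fin n => (g (x i.castSucc), π (reduce S (x i.castSucc))))
              (g (x (Fin.last n)))) ^ 2)
      ∂(Measure.pi (fun _ : Fin (n + 1) => μ)))
    / (Fintype.card (IndexSet d κ) : ℝ≥0∞)

/-- The real functions on `[0,1]^κ` that are Lipschitz with constant `L`. -/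
def lipschitzTargets (κ : ℕ) (L : ℝ≥0) : Set (Cube κ → ℝ) :=
  {π | ∀ u v, |π u - π v| ≤ L * euclDist u v}

/-- The bi-Lipschitz bijections of `[0,1]^d` onto itself with constant `L` both ways. -/
def biLipschitzEncoders (d : ℕ) (L : ℝ≥0) : Set (Cube d → Cube d) :=
  {g | Function.Bijective g ∧
    ∀ x y, euclDist (g x) (g y) ≤ L * euclDist x y ∧ euclDist x y ≤ L * euclDist (g x) (g y)}

/-- The target `y = x̃` for a single informative coordinate. -/
def coordTarget : Cube 1 → ℝ := fun u => (u 0 : ℝ)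

/-- The minimax squared error over decoders and worst-case encoders for the target `y = x̃`. -/
def encoderMinimaxRisk {d : ℕ} (n : ℕ) (L : ℝ≥0) (μ : Measure (Cube d)) : ℝ≥0∞ :=
  ⨅ f : Decoder d n, ⨆ g ∈ biLipschitzEncoders d L, iclRisk μ g coordTarget f

end

/-! ### Measurable selection -/

/-! Adaptation to unknown coordinates. Half of the sample, `A`, supplies candidate neighbours; the
rest, `B`, is held out. The decoder picks a coordinate set `S'` with the least empirical Lipschitz
constant on `A ∪ B` and returns the label of the `S'`-nearest neighbour in `A` of the test point
`t`. The true set `S` has score at most `L`, hence so has `S'`, although `S'` may be wrong. If `t`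
too is consistent with `A` in the coordinates `S'`, the error is at most `L` times an `S'`-distance
whose mean square is of order `n ^ (-2/κ)`. Otherwise `t` is the only obstruction to consistency on
`insert t A`. Removing a point cures a violating pair only if the point belongs to it, so by
exchangeability this has probability at most `2 / (|A| + 1)` (`measure_removal_le`). On that event a
detour through a point of `B` close to `t` in `S ∪ S'` bounds the error
(`abs_sub_le_of_consistent`). These are up to `2κ` coordinates, which only gives a mean square of
order `n ^ (-1/κ)`; but `B` is independent of the event, and `n ^ (-1/κ) * n ^ (-1) ≤ n ^ (-2/κ)`
because `κ ≥ 1`. A sum over all `S'` replaces the data-dependent choice.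

Unknown encoder, upper bound. A nearest neighbour among encoded points is, up to a factor `L ^ 2`, a
nearest neighbour among the inputs, and the label is 1-Lipschitz in the input.

Unknown encoder, lower bound. Cut the cube into `M ^ d` cells with `M` of order `n ^ (1/d)`, so that
the sample misses any given cell with probability at least 1/2. The encoder shifts one coordinate
`k` by a small bump in each cell, with a free sign per cell (`perturb`). A missed cell leaves no
trace of its sign in the data, while the two signs give the same encoded test point labels that
differ by a multiple of `1 / M` (`le_setLIntegral_cell_add`). Averaging over all sign patterns
(`le_iSup_iclRisk`) yields a risk of order `M ^ (-2)`. -/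

theorem exists_measurable_argmin {α ι : Type*} [MeasurableSpace α] [Finite ι] [Nonempty ι]
    (s : ι → α → ℝ≥0∞) (hs : ∀ i, Measurable (s i)) :
    ∃ m : α → ι, (∀ i, MeasurableSet (m ⁻¹' {i})) ∧ ∀ a i, s (m a) a ≤ s i a := by
  classical
  obtain ⟨k, ⟨e⟩⟩ := Finite.exists_equiv_fin ι
  -- Ties are broken by the enumeration `e`, so that each level set of `m` is a finite Boolean
  -- combination of comparisons of the scores.
  have hex : ∀ a, ∃ i, (∀ j, s i a ≤ s j a) ∧ ∀ i', e i' < e i → ¬ ∀ j, s i' a ≤ s j a := by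
    intro a
    obtain ⟨i0, hi0⟩ := Finite.exists_min (fun i => s i a)
    obtain ⟨i, hi, hmin⟩ := Set.exists_min_image {i | ∀ j, s i a ≤ s j a} e (Set.toFinite _)
      ⟨i0, hi0⟩
    exact ⟨i, hi, fun i' hlt hi' => absurd (hmin i' hi') (not_le.2 hlt)⟩
  choose m hm1 hm2 using hex
  refine ⟨m, fun i => ?_, hm1⟩
  have hset : m ⁻¹' {i} = {a | (∀ j, s i a ≤ s j a) ∧
      ∀ i', e i' < e i → ¬ ∀ j, s i' a ≤ s j a} := by
    ext a
    simp only [Set.mem_preimage, Set.mem_singleton_iff, Set.mem_ofPred_eq]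
    constructor
    · rintro rfl
      exact ⟨hm1 a, hm2 a⟩
    · rintro ⟨h1, h2⟩
      rcases lt_trichotomy (e (m a)) (e i) with h | h | h
      · exact absurd (hm1 a) (h2 _ h)
      · exact e.injective h
      · exact absurd h1 (hm2 a _ h)
  rw [hset]
  have hmin : ∀ i, MeasurableSet {a | ∀ j, s i a ≤ s j a} := fun i => by
    rw [Set.ofPred_forall]
    exact MeasurableSet.iInter fun j => measurableSet_le (hs i) (hs j)
  refine (hmin i).inter ?_
  change MeasurableSet {a | ∀ i', e i' < e i → ¬ ∀ j, s i' a ≤ s j a}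
  rw [Set.ofPred_forall]
  refine MeasurableSet.iInter fun i' => ?_
  by_cases h : e i' < e i
  · simp only [h, true_imp_iff]
    exact (hmin i').compl
  · simp [h]

theorem measurable_select {α ι β : Type*} [MeasurableSpace α] [MeasurableSpace β] [Finite ι]
    {m : α → ι} (hm : ∀ i, MeasurableSet (m ⁻¹' {i})) {F : ι → α → β}
    (hF : ∀ i, Measurable (F i)) : Measurable fun a => F (m a) a := by
  intro s hs
  have : (fun a => F (m a) a) ⁻¹' s = ⋃ i, m ⁻¹' {i} ∩ F i ⁻¹' s := by
    ext a; simp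
  rw [this]
  exact MeasurableSet.iUnion fun i => (hm i).inter (hF i hs)

/-! ### Measure of boxes under a law with bounded density -/

theorem IsInputLaw.le_apply {d : ℕ} {pmin pmax : ℝ} {μ : Measure (Cube d)}
    (h : IsInputLaw pmin pmax μ) {s : Set (Cube d)} (hs : MeasurableSet s) :
    ENNReal.ofReal pmin * volume s ≤ μ s := by
  obtain ⟨_, ρ, hρ, hb, rfl⟩ := h
  rw [withDensity_apply _ hs, ← setLIntegral_const]
  exact lintegral_mono fun x => ENNReal.ofReal_le_ofReal (hb x).1

theorem IsInputLaw.apply_le {d : ℕ} {pmin pmax : ℝ} {μ : Measure (Cube d)}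
    (h : IsInputLaw pmin pmax μ) {s : Set (Cube d)} (hs : MeasurableSet s) :
    μ s ≤ ENNReal.ofReal pmax * volume s := by
  obtain ⟨_, ρ, hρ, hb, rfl⟩ := h
  rw [withDensity_apply _ hs, ← setLIntegral_const]
  exact lintegral_mono fun x => ENNReal.ofReal_le_ofReal (hb x).2

theorem measurableSet_abs_sub_le (a r : ℝ) :
    MeasurableSet {s : unitInterval | |(s : ℝ) - a| ≤ r} :=
  measurableSet_le (by fun_prop) measurable_const

/-- Only `r`, not `2 * r`, is available: `t` may be an endpoint, where half of the interval falls
outside. -/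
theorem ofReal_le_volume_abs_sub_le (t : unitInterval) {r : ℝ} (hr0 : 0 ≤ r) (hr : r ≤ 1) :
    ENNReal.ofReal r ≤ volume {s : unitInterval | |(s : ℝ) - t| ≤ r} := by
  obtain ⟨t, h0, h1⟩ := t
  rw [unitInterval.volume_apply]
  have : Set.Icc (max 0 (t - r)) (min 1 (t + r)) ⊆
      Subtype.val '' {s : unitInterval | |(s : ℝ) - t| ≤ r} := by
    rintro u ⟨hu1, hu2⟩
    rw [max_le_iff] at hu1
    rw [le_min_iff] at hu2
    exact ⟨⟨u, hu1.1, hu2.1⟩, abs_le.2 ⟨show -r ≤ u - t by linarith [hu1.2], show u - t ≤ r by linarith [hu2.2]⟩, rfl⟩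
  refine le_trans ?_ (measure_mono this)
  rw [Real.volume_Icc]
  refine ENNReal.ofReal_le_ofReal ?_
  rcases max_cases 0 (t - r) with h | h <;> rcases min_cases 1 (t + r) with h' | h' <;> linarith

theorem IsInputLaw.le_measure_box {d : ℕ} {pmin pmax : ℝ} {μ : Measure (Cube d)}
    (h : IsInputLaw pmin pmax μ) (hp : 0 < pmin) (T : Finset (Fin d)) (t : Cube d) {r : ℝ}
    (hr0 : 0 ≤ r) (hr : r ≤ 1) :
    ENNReal.ofReal (pmin * r ^ T.card) ≤ μ {x | ∀ i ∈ T, |(x i : ℝ) - t i| ≤ r} := by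
  classical
  have hset : {x : Cube d | ∀ i ∈ T, |(x i : ℝ) - t i| ≤ r} =
      Set.pi Set.univ fun i => if i ∈ T then {s : unitInterval | |(s : ℝ) - t i| ≤ r}
        else Set.univ := by
    ext x
    simp only [Set.mem_ofPred_eq, Set.mem_pi, Set.mem_univ, true_imp_iff]
    refine forall_congr' fun i => ?_
    by_cases hi : i ∈ T <;> simp [hi]
  have hmeas : MeasurableSet {x : Cube d | ∀ i ∈ T, |(x i : ℝ) - t i| ≤ r} := by
    rw [hset]
    refine MeasurableSet.univ_pi fun i => ?_
    split_ifs
    · exact measurableSet_abs_sub_le _ _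
    · exact MeasurableSet.univ
  refine le_trans ?_ (h.le_apply hmeas)
  rw [ENNReal.ofReal_mul hp.le]
  gcongr
  rw [hset, volume_pi, Measure.pi_pi, ENNReal.ofReal_pow hr0, ← Finset.prod_const,
    ← Finset.prod_subset (Finset.subset_univ T) (f := fun i => volume (if i ∈ T then
      {s : unitInterval | |(s : ℝ) - t i| ≤ r} else Set.univ))]
  · refine Finset.prod_le_prod' fun i hi => ?_
    simpa [hi] using ofReal_le_volume_abs_sub_le (t i) hr0 hr
  · intro i _ hi
    simp [hi]

/-! ### Exchangeability -/

/-- Among i.i.d. points, a given one is rarely the only obstruction to a pairwise relation. -/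
theorem measure_removal_le {X ι : Type*} [MeasurableSpace X] [Fintype ι] [DecidableEq ι]
    (μ : Measure X) [IsProbabilityMeasure μ] (R : X → X → Prop)
    (hmeas : MeasurableSet {q : X × X | R q.1 q.2}) (P : Finset ι) {t : ι} (ht : t ∈ P) :
    Measure.pi (fun _ : ι => μ)
      {x | (∀ i ∈ P.erase t, ∀ j ∈ P.erase t, R (x i) (x j)) ∧
        ¬ ∀ i ∈ P, ∀ j ∈ P, R (x i) (x j)} ≤ 2 / (P.card : ℝ≥0∞) := by
  classical
  set ν := Measure.pi (fun _ : ι => μ)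
  set E : ι → Set (ι → X) := fun k => {x | (∀ i ∈ P.erase k, ∀ j ∈ P.erase k, R (x i) (x j)) ∧
        ¬ ∀ i ∈ P, ∀ j ∈ P, R (x i) (x j)} with hE
  have hC : ∀ Q : Finset ι, MeasurableSet {x : ι → X | ∀ i ∈ Q, ∀ j ∈ Q, R (x i) (x j)} := by
    intro Q
    have : {x : ι → X | ∀ i ∈ Q, ∀ j ∈ Q, R (x i) (x j)} =
        ⋂ i ∈ Q, ⋂ j ∈ Q, (fun x : ι → X => (x i, x j)) ⁻¹' {q | R q.1 q.2} := by
      ext x; simp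
    rw [this]
    refine Finset.measurableSet_biInter _ fun i _ => Finset.measurableSet_biInter _ fun j _ => ?_
    exact (by fun_prop : Measurable fun x : ι → X => (x i, x j)) hmeas
  have hEm : ∀ k, MeasurableSet (E k) := fun k => (hC _).inter (hC P).compl
  -- Exchangeability: the product measure is invariant under swapping `k` and `t`, and the swap
  -- carries one event to the other.
  have hsame : ∀ k ∈ P, ν (E k) = ν (E t) := by
    intro k hk
    have hmp := measurePreserving_piCongrLeft (fun _ : ι => μ) (Equiv.swap k t)
    rw [← hmp.measure_preimage (hEm k).nullMeasurableSet]
    congr 1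
    ext x
    have hval : ∀ i, (MeasurableEquiv.piCongrLeft (fun _ : ι => X) (Equiv.swap k t)) x i =
        x (Equiv.swap k t i) := by
      intro i
      have := Equiv.piCongrLeft_apply_apply (fun _ : ι => X) (Equiv.swap k t) x
        (Equiv.swap k t i)
      rw [Equiv.swap_apply_self] at this
      exact this
    have hperm : ∀ i, Equiv.swap k t i ∈ P ↔ i ∈ P := by
      intro i
      rcases eq_or_ne i k with rfl | h1
      · simp [hk, ht]
      rcases eq_or_ne i t with rfl | h2
      · simp [hk, ht]
      · rw [Equiv.swap_apply_of_ne_of_ne h1 h2]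
    have hperm' : ∀ i, Equiv.swap k t i ∈ P.erase t ↔ i ∈ P.erase k := by
      intro i
      rw [Finset.mem_erase, Finset.mem_erase, hperm, Ne, Ne, Equiv.swap_apply_eq_iff,
        Equiv.swap_apply_right]
    simp only [hE, Set.mem_preimage, Set.mem_ofPred_eq, hval]
    have key : ∀ Q Q' : Finset ι, (∀ i, Equiv.swap k t i ∈ Q' ↔ i ∈ Q) →
        ((∀ i ∈ Q, ∀ j ∈ Q, R (x (Equiv.swap k t i)) (x (Equiv.swap k t j))) ↔
          ∀ i ∈ Q', ∀ j ∈ Q', R (x i) (x j)) := by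
      intro Q Q' hQ
      constructor
      · intro h i hi j hj
        have := h (Equiv.swap k t i) (by rw [← hQ]; simpa using hi)
          (Equiv.swap k t j) (by rw [← hQ]; simpa using hj)
        simpa using this
      · intro h i hi j hj
        exact h _ ((hQ i).2 hi) _ ((hQ j).2 hj)
    rw [key _ _ hperm', key _ _ hperm]
  -- If the pair `i, j` violates `R`, only the removal of `i` or of `j` can restore it, so at most
  -- two of the events occur together.
  have hcount : ∀ x, ∑ k ∈ P, (E k).indicator (fun _ => (1 : ℝ≥0∞)) x ≤ 2 := by
    intro x
    by_cases hbad : ∀ i ∈ P, ∀ j ∈ P, R (x i) (x j)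
    · have : ∀ k ∈ P, (E k).indicator (fun _ => (1 : ℝ≥0∞)) x = 0 := fun k _ =>
        Set.indicator_of_notMem (fun h => h.2 hbad) _
      rw [Finset.sum_eq_zero this]
      exact zero_le
    · push Not at hbad
      obtain ⟨i, hi, j, hj, hij⟩ := hbad
      have h0 : ∀ k ∈ P, k ∉ ({i, j} : Finset ι) →
          (E k).indicator (fun _ => (1 : ℝ≥0∞)) x = 0 := by
        intro k _ hk
        simp only [Finset.mem_insert, Finset.mem_singleton, not_or] at hk
        refine Set.indicator_of_notMem (fun h => hij (h.1 i ?_ j ?_)) _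
        · exact Finset.mem_erase.2 ⟨Ne.symm hk.1, hi⟩
        · exact Finset.mem_erase.2 ⟨Ne.symm hk.2, hj⟩
      have hsub : ({i, j} : Finset ι) ⊆ P := by
        intro k hk
        simp only [Finset.mem_insert, Finset.mem_singleton] at hk
        rcases hk with rfl | rfl <;> assumption
      rw [← Finset.sum_subset hsub h0]
      calc ∑ k ∈ ({i, j} : Finset ι), (E k).indicator (fun _ => (1 : ℝ≥0∞)) x
          ≤ ∑ _k ∈ ({i, j} : Finset ι), (1 : ℝ≥0∞) :=
            Finset.sum_le_sum fun k _ => Set.indicator_le_self' (fun _ _ => zero_le) _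
        _ ≤ 2 := by
            rw [Finset.sum_const, nsmul_one]
            exact_mod_cast Finset.card_le_two
  have hP : (P.card : ℝ≥0∞) ≠ 0 := by
    exact_mod_cast (Finset.card_pos.2 ⟨t, ht⟩).ne'
  change ν (E t) ≤ _
  rw [ENNReal.le_div_iff_mul_le (Or.inl hP) (Or.inl (ENNReal.natCast_ne_top _))]
  calc ν (E t) * P.card = ∑ k ∈ P, ν (E k) := by
        rw [Finset.sum_congr rfl hsame, Finset.sum_const, nsmul_eq_mul, mul_comm]
    _ = ∫⁻ x, ∑ k ∈ P, (E k).indicator (fun _ => (1 : ℝ≥0∞)) x ∂ν := by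
        rw [lintegral_finsetSum _ fun k _ => measurable_const.indicator (hEm k)]
        refine Finset.sum_congr rfl fun k _ => ?_
        rw [lintegral_indicator_const (hEm k), one_mul]
    _ ≤ ∫⁻ _x, 2 ∂ν := lintegral_mono hcount
    _ = 2 := by simp [ν]

/-! ### Nearest-neighbour distances -/

/-- The distance, in the maximum norm of the coordinates in `T` and truncated at `1`, from the
point `x t` to the nearest of the points `x b` with `b ∈ B`. -/
noncomputable def nnDist {d : ℕ} {ι : Type*} (T : Finset (Fin d)) (B : Finset ι) (t : ι) (x : ι → Cube d) : ℝ :=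
  (min 1 (B.inf fun b => T.sup fun i => ENNReal.ofReal |(x b i : ℝ) - x t i|)).toReal

section nnDist

variable {d : ℕ} {ι : Type*} (T : Finset (Fin d)) (B : Finset ι) (t : ι)

theorem nnDist_nonneg (x : ι → Cube d) : 0 ≤ nnDist T B t x := ENNReal.toReal_nonneg

theorem nnDist_le_one (x : ι → Cube d) : nnDist T B t x ≤ 1 :=
  ENNReal.toReal_le_of_le_ofReal zero_le_one (by simp)

theorem measurable_nnDist [Countable ι] : Measurable (nnDist T B t : (ι → Cube d) → ℝ) := by
  unfold nnDist
  refine (measurable_const.min ?_).ennreal_toReal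
  have h1 : ∀ b, Measurable fun x : ι → Cube d =>
      T.sup fun i => ENNReal.ofReal |(x b i : ℝ) - x t i| := by
    intro b
    simp only [Finset.sup_eq_iSup]
    refine Measurable.iSup fun i => Measurable.iSup fun _ => ?_
    fun_prop
  simp only [Finset.inf_eq_iInf]
  exact Measurable.iInf fun b => Measurable.iInf fun _ => h1 b

theorem exists_lt_of_lt_nnDist {x : ι → Cube d} {r : ℝ} (hr : 0 ≤ r) (h : r < nnDist T B t x)
    {b : ι} (hb : b ∈ B) : ∃ i ∈ T, r < |(x b i : ℝ) - x t i| := by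
  by_contra! hcon
  refine absurd h (not_lt.2 ?_)
  refine ENNReal.toReal_le_of_le_ofReal hr ?_
  refine (min_le_right _ _).trans ((Finset.inf_le hb).trans ?_)
  exact Finset.sup_le fun i hi => ENNReal.ofReal_le_ofReal (hcon i hi)

theorem nnDist_eq_one_or (x : ι → Cube d) :
    nnDist T B t x = 1 ∨ ∃ b ∈ B, ∀ i ∈ T, |(x b i : ℝ) - x t i| ≤ nnDist T B t x := by
  rcases B.eq_empty_or_nonempty with rfl | hB
  · left; simp [nnDist]
  obtain ⟨b, hb, hbe⟩ := Finset.exists_mem_eq_inf B hB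
    (fun b => T.sup fun i => ENNReal.ofReal |(x b i : ℝ) - x t i|)
  rcases le_total 1 (B.inf fun b => T.sup fun i => ENNReal.ofReal |(x b i : ℝ) - x t i|)
    with h | h
  · left; simp [nnDist, min_eq_left h]
  · refine Or.inr ⟨b, hb, fun i hi => ?_⟩
    unfold nnDist
    rw [min_eq_right h, ← ENNReal.ofReal_le_iff_le_toReal (ne_top_of_le_ne_top ENNReal.one_ne_top h),
      hbe]
    exact Finset.le_sup (f := fun i => ENNReal.ofReal |(x b i : ℝ) - x t i|) hi

end nnDist

/-- The constant in the bounds on mean squared nearest-neighbour distances. -/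
noncomputable def nnConst (pmin : ℝ) (d : ℕ) : ℝ :=
  1 + ∑ m ∈ Finset.range (d + 1),
    2 * ((pmin / 2) ^ (-2 / (m : ℝ)) * (1 / (m : ℝ)) * Real.Gamma (2 / (m : ℝ)))

theorem nnConst_term_nonneg {pmin : ℝ} (hp : 0 < pmin) (m : ℕ) :
    0 ≤ 2 * ((pmin / 2) ^ (-2 / (m : ℝ)) * (1 / (m : ℝ)) * Real.Gamma (2 / (m : ℝ))) := by
  have : 0 ≤ Real.Gamma (2 / (m : ℝ)) := Real.Gamma_nonneg_of_nonneg (by positivity)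
  positivity

theorem one_le_nnConst {pmin : ℝ} (hp : 0 < pmin) (d : ℕ) : 1 ≤ nnConst pmin d :=
  le_add_of_nonneg_right (Finset.sum_nonneg fun m _ => nnConst_term_nonneg hp m)

theorem nnConst_term_le {pmin : ℝ} (hp : 0 < pmin) {m d : ℕ} (hm : m ≤ d) :
    2 * ((pmin / 2) ^ (-2 / (m : ℝ)) * (1 / (m : ℝ)) * Real.Gamma (2 / (m : ℝ))) ≤
      nnConst pmin d := by
  have := Finset.single_le_sum (fun m _ => nnConst_term_nonneg hp m)
    (Finset.mem_range.2 (Nat.lt_succ_of_le hm))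
  unfold nnConst
  linarith

/-- A layer-cake bound for the second moment of a variable with stretched exponential tails. -/
theorem lintegral_sq_le_of_tail {α : Type*} [MeasurableSpace α] {ν : Measure α} {f : α → ℝ}
    (hf : Measurable f) (hf0 : ∀ a, 0 ≤ f a) {b : ℝ} (hb : 0 < b) {m : ℕ} (hm : 1 ≤ m)
    (htail : ∀ r, 0 < r → ν {a | r < f a} ≤ ENNReal.ofReal (Real.exp (-b * r ^ m))) :
    ∫⁻ a, ENNReal.ofReal (f a ^ 2) ∂ν ≤ ENNReal.ofReal
      (2 * (b ^ (-2 / (m : ℝ)) * (1 / (m : ℝ)) * Real.Gamma (2 / (m : ℝ)))) := by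
  have hm0 : (0 : ℝ) < m := by exact_mod_cast hm
  have h := lintegral_rpow_eq_lintegral_meas_lt_mul ν (f := f) (Filter.Eventually.of_forall hf0)
    hf.aemeasurable (p := 2) two_pos
  simp only [Real.rpow_two] at h
  rw [h, ENNReal.ofReal_mul two_pos.le]
  gcongr
  have hI := integral_rpow_mul_exp_neg_mul_rpow (p := m) (q := 1) (b := b) hm0 (by norm_num) hb
  have hint := integrableOn_rpow_mul_exp_neg_mul_rpow (p := m) (s := 1) (b := b) (by norm_num)
    hm0 hb
  have e : (-(1 + 1) / (m : ℝ)) = -2 / (m : ℝ) := by norm_num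
  have e' : ((1 + 1) / (m : ℝ)) = 2 / (m : ℝ) := by norm_num
  rw [e, e'] at hI
  rw [← hI, ofReal_integral_eq_lintegral_ofReal hint]
  · refine setLIntegral_mono' measurableSet_Ioi fun r hr => ?_
    have hr0 : 0 < r := hr
    rw [mul_comm, ENNReal.ofReal_mul (by positivity), Real.rpow_natCast,
      show (2 - 1 : ℝ) = 1 by norm_num]
    exact mul_le_mul_right (htail r hr) _
  · filter_upwards [ae_restrict_mem measurableSet_Ioi] with r hr
    have hr0 : 0 < r := hr
    simp only [Pi.zero_apply]
    positivity

/-- Every point of `B` must miss the box of radius `r` around `x t`, which has mass at least `pmin *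
r ^ |T|`. As `t ∉ B`, this box stays fixed while `B` is drawn, and `(1 - q) ^ |B| ≤ exp (-q * |B|)`.
-/
theorem measure_lt_nnDist_le {d : ℕ} {ι : Type*} [Fintype ι] [DecidableEq ι] {pmin pmax : ℝ}
    {μ : Measure (Cube d)} (h : IsInputLaw pmin pmax μ) (hp : 0 < pmin) (T : Finset (Fin d))
    (B : Finset ι) {t : ι} (ht : t ∉ B) (x : ι → Cube d) {r : ℝ} (hr : 0 < r) :
    Measure.pi (fun _ : B => μ) {y | r < nnDist T B t (Function.updateFinset x B y)} ≤
      ENNReal.ofReal (Real.exp (-(pmin * B.card) * r ^ T.card)) := by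
  have hprob : IsProbabilityMeasure μ := h.1
  -- The truncation of `nnDist` at `1` empties the event for `r ≥ 1`.
  rcases le_or_gt 1 r with h1 | h1
  · have : {y : B → Cube d | r < nnDist T B t (Function.updateFinset x B y)} = ∅ := by
      ext y
      simpa using (nnDist_le_one T B t _).trans h1
    rw [this, measure_empty]
    exact zero_le
  set E : Set (Cube d) := {z | ∀ i ∈ T, |(z i : ℝ) - x t i| ≤ r} with hE
  have hEm : MeasurableSet E := by
    have : E = ⋂ i ∈ T, {z | |(z i : ℝ) - x t i| ≤ r} := by ext z; simp [hE]
    rw [this]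
    exact Finset.measurableSet_biInter _ fun i _ => measurableSet_le (by fun_prop) measurable_const
  have hsub : {y : B → Cube d | r < nnDist T B t (Function.updateFinset x B y)} ⊆
      Set.pi Set.univ fun _ => Eᶜ := by
    intro y hy b _ hb
    obtain ⟨i, hi, hlt⟩ := exists_lt_of_lt_nnDist T B t hr.le hy b.2
    have := hb i hi
    simp only [Function.updateFinset, b.2, ht, dif_pos, dif_neg, not_false_iff] at hlt
    exact absurd this (not_le.2 hlt)
  refine (measure_mono hsub).trans ?_
  rw [Measure.pi_pi, Finset.prod_const, Finset.card_univ, Fintype.card_coe]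
  have hE1 := h.le_measure_box hp T (x t) hr.le h1.le
  have hq : pmin * r ^ T.card ≤ 1 := by
    have := hE1.trans prob_le_one
    rwa [← ENNReal.ofReal_one, ENNReal.ofReal_le_ofReal_iff zero_le_one] at this
  have hc : μ Eᶜ ≤ ENNReal.ofReal (Real.exp (-(pmin * r ^ T.card))) := by
    rw [prob_compl_eq_one_sub hEm]
    refine (tsub_le_tsub_left hE1 1).trans ?_
    rw [← ENNReal.ofReal_one, ← ENNReal.ofReal_sub _ (by positivity)]
    exact ENNReal.ofReal_le_ofReal (Real.one_sub_le_exp_neg _)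
  calc μ Eᶜ ^ B.card ≤ ENNReal.ofReal (Real.exp (-(pmin * r ^ T.card))) ^ B.card := by gcongr
    _ = _ := by
      rw [← ENNReal.ofReal_pow (Real.exp_pos _).le, ← Real.exp_nat_mul]
      congr 2
      ring

/-- The mean squared nearest-neighbour distance, weighted by a function of the other points. -/
theorem lintegral_mul_nnDist_sq_le {d : ℕ} {ι : Type*} [Fintype ι] [DecidableEq ι] {pmin pmax : ℝ}
    {μ : Measure (Cube d)} (h : IsInputLaw pmin pmax μ) (hp : 0 < pmin) {T : Finset (Fin d)}
    (hT : 1 ≤ T.card) (B : Finset ι) {t : ι} (ht : t ∉ B) {W : (ι → Cube d) → ℝ≥0∞}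
    (hW : Measurable W) (hWB : ∀ x (y : B → Cube d), W (Function.updateFinset x B y) = W x) :
    ∫⁻ x, W x * ENNReal.ofReal (nnDist T B t x ^ 2) ∂Measure.pi (fun _ : ι => μ) ≤
      ENNReal.ofReal (nnConst pmin d * ((B.card : ℝ) + 1) ^ (-2 / (T.card : ℝ))) *
        ∫⁻ x, W x ∂Measure.pi (fun _ : ι => μ) := by
  have hprob : IsProbabilityMeasure μ := h.1
  set m := T.card with hm
  have hm0 : (0 : ℝ) < m := by exact_mod_cast hT
  have hmd : m ≤ d := by simpa using Finset.card_le_univ T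
  set K := ENNReal.ofReal (nnConst pmin d * ((B.card : ℝ) + 1) ^ (-2 / (m : ℝ))) with hK
  have hD : Measurable fun x : ι → Cube d => ENNReal.ofReal (nnDist T B t x ^ 2) :=
    ((measurable_nnDist T B t).pow_const 2).ennreal_ofReal
  have hinner : ∀ x : ι → Cube d, ∫⁻ y, ENNReal.ofReal
      (nnDist T B t (Function.updateFinset x B y) ^ 2) ∂Measure.pi (fun _ : B => μ) ≤ K := by
    intro x
    -- With no points in `B` the truncated distance is at most `1`; the summand `1` of `nnConst`
    -- covers this case.
    rcases Nat.eq_zero_or_pos B.card with h0 | h0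
    · have hK1 : 1 ≤ K := by
        rw [hK, h0]
        simpa using one_le_nnConst hp d
      calc _ ≤ ∫⁻ _y, 1 ∂Measure.pi (fun _ : B => μ) := by
            refine lintegral_mono fun y => ?_
            rw [← ENNReal.ofReal_one]
            exact ENNReal.ofReal_le_ofReal
              (pow_le_one₀ (nnDist_nonneg _ _ _ _) (nnDist_le_one _ _ _ _))
        _ ≤ K := by simpa using hK1
    · have hB : (1 : ℝ) ≤ B.card := by exact_mod_cast h0
      refine (lintegral_sq_le_of_tail
        ((measurable_nnDist T B t).comp measurable_updateFinset)
        (fun y => nnDist_nonneg _ _ _ _) (b := pmin * B.card) (by positivity) hT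
        fun r hr => ?_).trans ?_
      · simpa only [hm, Function.comp_apply] using measure_lt_nnDist_le h hp T B ht x hr
      · refine ENNReal.ofReal_le_ofReal ?_
        have hG : 0 ≤ Real.Gamma (2 / (m : ℝ)) := Real.Gamma_nonneg_of_nonneg (by positivity)
        -- A nonempty `B` satisfies `|B| ≥ (|B| + 1) / 2`; hence the `pmin / 2` in `nnConst`.
        have hb : (pmin * B.card) ^ (-2 / (m : ℝ)) ≤
            (pmin / 2) ^ (-2 / (m : ℝ)) * ((B.card : ℝ) + 1) ^ (-2 / (m : ℝ)) := by
          rw [← Real.mul_rpow (by positivity) (by positivity)]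
          refine Real.rpow_le_rpow_of_nonpos (by positivity) ?_ ?_
          · nlinarith
          · exact div_nonpos_of_nonpos_of_nonneg (by norm_num) hm0.le
        calc 2 * ((pmin * B.card) ^ (-2 / (m : ℝ)) * (1 / (m : ℝ)) * Real.Gamma (2 / (m : ℝ)))
            ≤ 2 * ((pmin / 2) ^ (-2 / (m : ℝ)) * ((B.card : ℝ) + 1) ^ (-2 / (m : ℝ))
                * (1 / (m : ℝ)) * Real.Gamma (2 / (m : ℝ))) := by gcongr
          _ = 2 * ((pmin / 2) ^ (-2 / (m : ℝ)) * (1 / (m : ℝ)) * Real.Gamma (2 / (m : ℝ)))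
                * ((B.card : ℝ) + 1) ^ (-2 / (m : ℝ)) := by ring
          _ ≤ _ := by
            gcongr
            exact nnConst_term_le hp hmd
  rw [← lintegral_const_mul _ hW]
  -- Integrating first over the points of `B`, which `W` does not see, lets `W` be pulled out and
  -- leaves the uniform bound `hinner`.
  refine lintegral_le_of_lmarginal_le B (hW.mul hD) (hW.const_mul K) fun x => ?_
  unfold lmarginal
  simp only [hWB]
  have hD' : Measurable fun y : B → Cube d =>
      ENNReal.ofReal (nnDist T B t (Function.updateFinset x B y) ^ 2) :=
    hD.comp measurable_updateFinset
  rw [lintegral_const_mul _ hD', lintegral_const, measure_univ,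
    mul_one, mul_comm K]
  gcongr
  exact hinner x

/-! ### The Euclidean distance on the cube -/

theorem euclDist_eq_dist {d : ℕ} (x y : Cube d) :
    euclDist x y = dist (WithLp.toLp 2 fun i => (x i : ℝ) : EuclideanSpace ℝ (Fin d))
      (WithLp.toLp 2 fun i => (y i : ℝ)) := by
  simp [euclDist, EuclideanSpace.dist_eq, Real.dist_eq, sq_abs]

theorem euclDist_nonneg {d : ℕ} (x y : Cube d) : 0 ≤ euclDist x y := Real.sqrt_nonneg _

theorem euclDist_comm {d : ℕ} (x y : Cube d) : euclDist x y = euclDist y x := by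
  simp only [euclDist_eq_dist, dist_comm]

theorem euclDist_triangle {d : ℕ} (x y z : Cube d) :
    euclDist x z ≤ euclDist x y + euclDist y z := by
  simp only [euclDist_eq_dist, dist_triangle]

theorem euclDist_le_of_abs_le {d : ℕ} {x y : Cube d} {r : ℝ} (hr : 0 ≤ r)
    (h : ∀ i, |(x i : ℝ) - y i| ≤ r) : euclDist x y ≤ Real.sqrt d * r := by
  unfold euclDist
  refine Real.sqrt_le_iff.2 ⟨by positivity, ?_⟩
  rw [mul_pow, Real.sq_sqrt (Nat.cast_nonneg d)]
  calc ∑ i, ((x i : ℝ) - y i) ^ 2 ≤ ∑ _i : Fin d, r ^ 2 :=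
        Finset.sum_le_sum fun i _ => sq_le_sq' (abs_le.1 (h i)).1 (abs_le.1 (h i)).2
    _ = d * r ^ 2 := by simp

theorem abs_sub_le_euclDist {d : ℕ} (x y : Cube d) (i : Fin d) :
    |(x i : ℝ) - y i| ≤ euclDist x y := by
  refine Real.abs_le_sqrt ?_
  exact Finset.single_le_sum (f := fun i => ((x i : ℝ) - y i) ^ 2) (fun i _ => sq_nonneg _)
    (Finset.mem_univ i)

theorem Measurable.euclDist {α : Type*} [MeasurableSpace α] {d : ℕ} {f g : α → Cube d}
    (hf : Measurable f) (hg : Measurable g) : Measurable fun a => euclDist (f a) (g a) := by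
  unfold _root_.euclDist
  fun_prop

theorem measurable_reduce {d κ : ℕ} (S : IndexSet d κ) : Measurable (reduce S) := by
  unfold reduce
  fun_prop

theorem euclDist_reduce_le {d κ : ℕ} (S : IndexSet d κ) {x y : Cube d} {r : ℝ} (hr : 0 ≤ r)
    (h : ∀ i ∈ S.1, |(x i : ℝ) - y i| ≤ r) :
    euclDist (reduce S x) (reduce S y) ≤ Real.sqrt κ * r :=
  euclDist_le_of_abs_le hr fun j => h _ (Finset.orderEmbOfFin_mem S.1 S.2 j)

theorem measurable_of_mem_lipschitzTargets {κ : ℕ} {L : ℝ≥0} {π : Cube κ → ℝ}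
    (hπ : π ∈ lipschitzTargets κ L) : Measurable π := by
  refine Continuous.measurable (Metric.continuous_iff.2 fun u ε hε => ?_)
  have hc : 0 < (L : ℝ) * Real.sqrt κ + 1 := by positivity
  refine ⟨ε / (L * Real.sqrt κ + 1), by positivity, fun v hv => ?_⟩
  rw [Real.dist_eq]
  have h1 : euclDist v u ≤ Real.sqrt κ * dist v u :=
    euclDist_le_of_abs_le dist_nonneg fun i => by
      simpa [Subtype.dist_eq, Real.dist_eq] using dist_le_pi_dist v u i
  have h2 : |π v - π u| ≤ L * (Real.sqrt κ * dist v u) :=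
    (hπ v u).trans (mul_le_mul_of_nonneg_left h1 L.2)
  have h3 : dist v u * (L * Real.sqrt κ + 1) < ε := (lt_div_iff₀ hc).1 hv
  nlinarith [dist_nonneg (x := v) (y := u)]

/-! ### The decoder for unknown coordinates -/

/-- The least Lipschitz constant of the labels with respect to the coordinates in `S`. -/
noncomputable def lipschitzScore {d κ n : ℕ} (S : IndexSet d κ) (data : Fin n → Cube d × ℝ) :
    ℝ≥0∞ :=
  ⨆ i, ⨆ k, ENNReal.ofReal |(data i).2 - (data k).2| /
    ENNReal.ofReal (euclDist (reduce S (data i).1) (reduce S (data k).1))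

theorem measurable_lipschitzScore {d κ n : ℕ} (S : IndexSet d κ) :
    Measurable (lipschitzScore S : (Fin n → Cube d × ℝ) → ℝ≥0∞) := by
  unfold lipschitzScore
  refine Measurable.iSup fun i => Measurable.iSup fun k => Measurable.div ?_ ?_
  · fun_prop
  · exact (((measurable_reduce S).comp (by fun_prop)).euclDist
      ((measurable_reduce S).comp (by fun_prop))).ennreal_ofReal

theorem lipschitzScore_le_iff {d κ n : ℕ} (S : IndexSet d κ) (data : Fin n → Cube d × ℝ)
    (L : ℝ≥0) : lipschitzScore S data ≤ L ↔
      ∀ i k, |(data i).2 - (data k).2| ≤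
        L * euclDist (reduce S (data i).1) (reduce S (data k).1) := by
  unfold lipschitzScore
  simp only [iSup_le_iff]
  refine forall₂_congr fun i k => ?_
  -- No case split at distance zero is needed: the quotient is then `0` for equal labels and `∞`
  -- otherwise, and `L` is finite.
  rw [ENNReal.div_le_iff_le_mul (Or.inr ENNReal.coe_ne_top) (Or.inl ENNReal.ofReal_ne_top),
    ← ENNReal.ofReal_coe_nnreal, ← ENNReal.ofReal_mul L.coe_nonneg,
    ENNReal.ofReal_le_ofReal_iff (mul_nonneg L.coe_nonneg (euclDist_nonneg _ _))]

theorem exists_nearestNeighbour_decoder (d κ n : ℕ) (hκ : κ ≤ d) (hn : 1 ≤ n) :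
    ∃ f : Decoder d n, ∃ A : Finset (Fin n), n ≤ 2 * A.card ∧ n ≤ 2 * (Aᶜ.card + 1) ∧
      ∀ data t, ∃ S : IndexSet d κ, ∃ j ∈ A, f.1 data t = (data j).2 ∧
        (∀ S' : IndexSet d κ, lipschitzScore S data ≤ lipschitzScore S' data) ∧
        ∀ b ∈ A, euclDist (reduce S (data j).1) (reduce S t) ≤
          euclDist (reduce S (data b).1) (reduce S t) := by
  -- Rounding up keeps `A` nonempty for `n = 1`; its complement may then be empty, whence the `+ 1`
  -- in its size bound.
  obtain ⟨A, -, hA⟩ := Finset.exists_subset_card_eq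
    (s := (Finset.univ : Finset (Fin n))) (n := (n + 1) / 2) (by rw [Finset.card_fin]; omega)
  have hAc : Aᶜ.card = n - (n + 1) / 2 := by rw [Finset.card_compl, hA, Fintype.card_fin]
  have hne : Nonempty A := by
    obtain ⟨a, ha⟩ := Finset.card_pos.1 (show 0 < A.card by omega)
    exact ⟨⟨a, ha⟩⟩
  have hneS : Nonempty (IndexSet d κ) := by
    obtain ⟨S, -, hS⟩ := Finset.exists_subset_card_eq
      (s := (Finset.univ : Finset (Fin d))) (n := κ) (by simpa using hκ)
    exact ⟨⟨S, hS⟩⟩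
  obtain ⟨mS, hmS, hmS'⟩ := exists_measurable_argmin
    (fun (S : IndexSet d κ) (data : Fin n → Cube d × ℝ) => lipschitzScore S data)
    fun S => measurable_lipschitzScore S
  have hJ := fun S : IndexSet d κ => exists_measurable_argmin
    (fun (j : A) (q : (Fin n → Cube d × ℝ) × Cube d) =>
      ENNReal.ofReal (euclDist (reduce S (q.1 j).1) (reduce S q.2)))
    fun j => (((measurable_reduce S).comp (by fun_prop)).euclDist
      ((measurable_reduce S).comp (by fun_prop))).ennreal_ofReal
  choose mJ hmJ hmJ' using hJ
  refine ⟨⟨fun data t => (data (mJ (mS data) (data, t))).2, ?_⟩, A, by omega, by omega, ?_⟩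
  · refine measurable_select (m := fun q : (Fin n → Cube d × ℝ) × Cube d => mS q.1)
      (F := fun S q => (q.1 (mJ S q)).2) (fun S => measurable_fst (hmS S)) fun S => ?_
    exact measurable_select (F := fun (j : A) (q : (Fin n → Cube d × ℝ) × Cube d) => (q.1 j).2)
      (hmJ S) fun j => by fun_prop
  · intro data t
    refine ⟨mS data, mJ (mS data) (data, t), (mJ _ _).2, rfl, hmS' data, fun b hb => ?_⟩
    exact (ENNReal.ofReal_le_ofReal_iff (euclDist_nonneg _ _)).1 (hmJ' (mS data) (data, t) ⟨b, hb⟩)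

/-! ### Risk of the decoder -/

/-- The labels, read through `S`, are `L`-Lipschitz in the coordinates `S'` on the pair `u, v`. -/
def PairConsistent {d κ : ℕ} (π : Cube κ → ℝ) (L : ℝ≥0) (S S' : IndexSet d κ) (u v : Cube d) :
    Prop :=
  |π (reduce S u) - π (reduce S v)| ≤ L * euclDist (reduce S' u) (reduce S' v)

/-- The point `t` is the only obstruction to consistency on `insert t A`. -/
def obstruction {d κ : ℕ} {ι : Type*} [DecidableEq ι] (π : Cube κ → ℝ) (L : ℝ≥0)
    (S S' : IndexSet d κ) (A : Finset ι) (t : ι) : Set (ι → Cube d) :=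
  {x | (∀ i ∈ A, ∀ j ∈ A, PairConsistent π L S S' (x i) (x j)) ∧
    ¬ ∀ i ∈ insert t A, ∀ j ∈ insert t A, PairConsistent π L S S' (x i) (x j)}

theorem measurableSet_pairConsistent {d κ : ℕ} {π : Cube κ → ℝ} (hπ : Measurable π) (L : ℝ≥0)
    (S S' : IndexSet d κ) :
    MeasurableSet {q : Cube d × Cube d | PairConsistent π L S S' q.1 q.2} := by
  refine measurableSet_le ?_ ?_
  · have h1 : Measurable fun q : Cube d × Cube d => π (reduce S q.1) :=
      hπ.comp ((measurable_reduce S).comp measurable_fst)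
    have h2 : Measurable fun q : Cube d × Cube d => π (reduce S q.2) :=
      hπ.comp ((measurable_reduce S).comp measurable_snd)
    exact (h1.sub h2).abs
  · exact (((measurable_reduce S').comp measurable_fst).euclDist
      ((measurable_reduce S').comp measurable_snd)).const_mul _

theorem measurableSet_obstruction {d κ : ℕ} {ι : Type*} [Fintype ι] [DecidableEq ι]
    {π : Cube κ → ℝ} (hπ : Measurable π) (L : ℝ≥0) (S S' : IndexSet d κ) (A : Finset ι) (t : ι) :
    MeasurableSet (obstruction π L S S' A t) := by
  have hC : ∀ Q : Finset ι, MeasurableSet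
      {x : ι → Cube d | ∀ i ∈ Q, ∀ j ∈ Q, PairConsistent π L S S' (x i) (x j)} := by
    intro Q
    have : {x : ι → Cube d | ∀ i ∈ Q, ∀ j ∈ Q, PairConsistent π L S S' (x i) (x j)} =
        ⋂ i ∈ Q, ⋂ j ∈ Q, (fun x : ι → Cube d => (x i, x j)) ⁻¹'
          {q | PairConsistent π L S S' q.1 q.2} := by
      ext x; simp
    rw [this]
    refine Finset.measurableSet_biInter _ fun i _ => Finset.measurableSet_biInter _ fun j _ => ?_
    exact (by fun_prop : Measurable fun x : ι → Cube d => (x i, x j))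
      (measurableSet_pairConsistent hπ L S S')
  exact (hC _).inter (hC _).compl

theorem measure_obstruction_le {d κ : ℕ} {ι : Type*} [Fintype ι] [DecidableEq ι]
    (μ : Measure (Cube d)) [IsProbabilityMeasure μ]
    {π : Cube κ → ℝ} (hπ : Measurable π) (L : ℝ≥0) (S S' : IndexSet d κ) {A : Finset ι} {t : ι}
    (ht : t ∉ A) : Measure.pi (fun _ : ι => μ) (obstruction π L S S' A t) ≤
      ENNReal.ofReal (2 / ((A.card : ℝ) + 1)) := by
  have h := measure_removal_le μ (PairConsistent π L S S') (measurableSet_pairConsistent hπ L S S')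
    (insert t A) (Finset.mem_insert_self t A)
  rw [Finset.erase_insert ht, Finset.card_insert_of_notMem ht] at h
  rw [ENNReal.ofReal_div_of_pos (by positivity)]
  refine h.trans (le_of_eq ?_)
  congr 1
  · simp
  · rw [← ENNReal.ofReal_natCast]
    push_cast
    rfl

/-- Nearest neighbours with respect to coordinates `S'` that are consistent with all labels. -/
theorem abs_sub_le_of_consistent {d κ : ℕ} {ι : Type*} [DecidableEq ι] {π : Cube κ → ℝ} {L : ℝ≥0}
    (hπ : π ∈ lipschitzTargets κ L) (S S' : IndexSet d κ) {A B : Finset ι} {t : ι}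
    {x : ι → Cube d}
    (hcons : ∀ i ∈ A ∪ B, ∀ j ∈ A ∪ B, PairConsistent π L S S' (x i) (x j)) {j : ι} (hj : j ∈ A)
    (hnn : ∀ b ∈ A, euclDist (reduce S' (x j)) (reduce S' (x t)) ≤
      euclDist (reduce S' (x b)) (reduce S' (x t))) :
    |π (reduce S (x t)) - π (reduce S (x j))| ≤ L * Real.sqrt κ * (nnDist S'.1 A t x +
      2 * (obstruction π L S S' A t).indicator (fun x => nnDist (S.1 ∪ S'.1) B t x) x) := by
  have hL : (0 : ℝ) ≤ L := L.2
  have hdA : euclDist (reduce S' (x j)) (reduce S' (x t)) ≤ Real.sqrt κ * nnDist S'.1 A t x := by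
    -- A truncated distance equal to `1` gives nothing about neighbours, but then the diameter of
    -- the cube suffices.
    rcases nnDist_eq_one_or S'.1 A t x with h | ⟨b, hb, h⟩
    · rw [h]
      refine euclDist_reduce_le _ zero_le_one fun i _ => ?_
      exact abs_le.2 ⟨by linarith [(x j i).2.1, (x t i).2.2], by linarith [(x j i).2.2, (x t i).2.1]⟩
    · exact (hnn b hb).trans (euclDist_reduce_le _ (nnDist_nonneg _ _ _ _) h)
  by_cases hE : x ∈ obstruction π L S S' A t
  · rw [Set.indicator_of_mem hE]
    have hsA : 0 ≤ L * Real.sqrt κ * nnDist S'.1 A t x :=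
      mul_nonneg (by positivity) (nnDist_nonneg _ _ _ _)
    rcases nnDist_eq_one_or (S.1 ∪ S'.1) B t x with h | ⟨b, hb, h⟩
    · rw [h]
      have h1 : euclDist (reduce S (x t)) (reduce S (x j)) ≤ Real.sqrt κ * 1 := by
        refine euclDist_reduce_le _ zero_le_one fun i _ => ?_
        exact abs_le.2 ⟨by linarith [(x j i).2.2, (x t i).2.1],
          by linarith [(x j i).2.1, (x t i).2.2]⟩
      have h2 := (hπ (reduce S (x t)) (reduce S (x j))).trans (mul_le_mul_of_nonneg_left h1 hL)
      have h3 : 0 ≤ L * Real.sqrt κ := by positivity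
      nlinarith
    -- The detour `t → b → j`: closeness of `b` to `t` in `S` compares their labels, consistency in
    -- `S'` compares those of `b` and `j`, and closeness in `S'` bounds the distance from `b` to
    -- `j`. The distance to `b` thus enters twice.
    · have h0 := nnDist_nonneg (S.1 ∪ S'.1) B t x
      have h1 : euclDist (reduce S (x b)) (reduce S (x t)) ≤
          Real.sqrt κ * nnDist (S.1 ∪ S'.1) B t x :=
        euclDist_reduce_le _ h0 fun i hi => h i (Finset.mem_union_left _ hi)
      have h2 : euclDist (reduce S' (x b)) (reduce S' (x t)) ≤
          Real.sqrt κ * nnDist (S.1 ∪ S'.1) B t x :=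
        euclDist_reduce_le _ h0 fun i hi => h i (Finset.mem_union_right _ hi)
      have h3 := hπ (reduce S (x t)) (reduce S (x b))
      rw [euclDist_comm] at h3
      have h4 : |π (reduce S (x b)) - π (reduce S (x j))| ≤ _ :=
        hcons b (Finset.mem_union_right _ hb) j (Finset.mem_union_left _ hj)
      have h5 := euclDist_triangle (reduce S' (x b)) (reduce S' (x t)) (reduce S' (x j))
      rw [euclDist_comm (reduce S' (x t))] at h5
      have h6 := abs_sub_le (π (reduce S (x t))) (π (reduce S (x b))) (π (reduce S (x j)))
      have h7 := mul_le_mul_of_nonneg_left h1 hL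
      have h8 := mul_le_mul_of_nonneg_left (h5.trans (add_le_add h2 hdA)) hL
      linarith
  · rw [Set.indicator_of_notMem hE, mul_zero, add_zero]
    -- `A` itself is consistent, so a failure on `insert t A` would be an obstruction caused by `t`.
    have hall : ∀ i ∈ insert t A, ∀ j ∈ insert t A, PairConsistent π L S S' (x i) (x j) := by
      by_contra hcon
      exact hE ⟨fun i hi j hj => hcons i (Finset.mem_union_left _ hi) j
        (Finset.mem_union_left _ hj), hcon⟩
    have h1 : |π (reduce S (x t)) - π (reduce S (x j))| ≤ _ :=
      hall t (Finset.mem_insert_self _ _) j (Finset.mem_insert_of_mem hj)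
    rw [euclDist_comm] at h1
    refine h1.trans ?_
    rw [mul_assoc]
    exact mul_le_mul_of_nonneg_left hdA hL

/-- This is the independence of the obstruction from the held-out points, in the form required of
the weight `W` in `lintegral_mul_nnDist_sq_le`. -/
theorem obstruction_updateFinset_iff {d κ : ℕ} {ι : Type*} [DecidableEq ι] (π : Cube κ → ℝ)
    (L : ℝ≥0) (S S' : IndexSet d κ) {A B : Finset ι} {t : ι} (hAB : Disjoint A B) (ht : t ∉ B)
    (x : ι → Cube d) (y : B → Cube d) :
    Function.updateFinset x B y ∈ obstruction π L S S' A t ↔ x ∈ obstruction π L S S' A t := by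
  have hv : ∀ i ∈ insert t A, Function.updateFinset x B y i = x i := by
    intro i hi
    have : i ∉ B := by
      rcases Finset.mem_insert.1 hi with rfl | hi
      · exact ht
      · exact Finset.disjoint_left.1 hAB hi
    simp [Function.updateFinset, this]
  have hQ : ∀ Q ⊆ insert t A,
      ((∀ i ∈ Q, ∀ j ∈ Q, PairConsistent π L S S' (Function.updateFinset x B y i)
        (Function.updateFinset x B y j)) ↔ ∀ i ∈ Q, ∀ j ∈ Q, PairConsistent π L S S' (x i) (x j)) :=
    fun Q hQ => forall₂_congr fun i hi => forall₂_congr fun j hj => by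
      rw [hv i (hQ hi), hv j (hQ hj)]
  unfold obstruction
  rw [Set.mem_ofPred_eq, Set.mem_ofPred_eq, hQ A (Finset.subset_insert _ _),
    hQ _ Finset.Subset.rfl]

theorem half_rpow_le {a n κ : ℝ} (hn : 1 ≤ n) (hκ : 1 ≤ κ) (ha : n / 2 ≤ a) :
    a ^ (-2 / κ) ≤ 4 * n ^ (-2 / κ) := by
  have hs : -2 / κ ≤ 0 := div_nonpos_of_nonpos_of_nonneg (by norm_num) (by linarith)
  have h1 : a ^ (-2 / κ) ≤ (n / 2) ^ (-2 / κ) :=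
    Real.rpow_le_rpow_of_nonpos (by linarith) ha hs
  have h2 : (n / 2) ^ (-2 / κ) = (1 / 2 : ℝ) ^ (-2 / κ) * n ^ (-2 / κ) := by
    rw [← Real.mul_rpow (by norm_num) (by linarith)]
    congr 1
    ring
  have h3 : (1 / 2 : ℝ) ^ (-2 / κ) ≤ (1 / 2 : ℝ) ^ (-2 : ℝ) := by
    refine Real.rpow_le_rpow_of_exponent_ge (by norm_num) (by norm_num) ?_
    rw [le_div_iff₀ (by linarith)]
    linarith
  have h4 : (1 / 2 : ℝ) ^ (-2 : ℝ) = 4 := by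
    rw [show (-2 : ℝ) = ((-2 : ℤ) : ℝ) by norm_num, Real.rpow_intCast]
    norm_num
  rw [h4] at h3
  exact (h1.trans h2.le).trans (mul_le_mul_of_nonneg_right h3 (Real.rpow_nonneg (by linarith) _))

/-- The slow rate in up to `2κ` coordinates is compensated by the obstruction probability: `n ^
(-1/κ) * n ^ (-1) ≤ n ^ (-2/κ)`, where `κ ≥ 1` is essential. -/
theorem rpow_mul_inv_le {a b n κ m : ℝ} (hn : 1 ≤ n) (hκ : 1 ≤ κ) (hm0 : 0 < m) (hm : m ≤ 2 * κ)
    (ha : n / 2 ≤ a) (hb1 : 1 ≤ b) (hb : n / 2 ≤ b) :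
    b ^ (-2 / m) * (2 / a) ≤ 16 * n ^ (-2 / κ) := by
  have hn0 : 0 < n := by linarith
  have h1 : b ^ (-2 / m) ≤ b ^ (-2 / (2 * κ)) := by
    refine Real.rpow_le_rpow_of_exponent_le hb1 ?_
    rw [neg_div, neg_div, neg_le_neg_iff]
    exact div_le_div_of_nonneg_left (by norm_num) hm0 hm
  have h2 := half_rpow_le hn (by linarith : 1 ≤ 2 * κ) hb
  have h3 : 2 / a ≤ 4 * n⁻¹ := by
    rw [div_le_iff₀ (by linarith)]
    have : 4 * n⁻¹ * (n / 2) = 2 := by field_simp; norm_num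
    have h5 : 0 < n⁻¹ := by positivity
    nlinarith
  have h4 : n ^ (-2 / (2 * κ)) * n⁻¹ ≤ n ^ (-2 / κ) := by
    rw [← Real.rpow_neg_one, ← Real.rpow_add hn0]
    refine Real.rpow_le_rpow_of_exponent_le hn ?_
    have : -2 / (2 * κ) = -1 / κ := by field_simp
    have h6 : 1 / κ ≤ 1 := by rw [div_le_one (by linarith)]; exact hκ
    have h7 : -2 / κ = -1 / κ - 1 / κ := by ring
    rw [this, h7]
    linarith
  calc b ^ (-2 / m) * (2 / a) ≤ (4 * n ^ (-2 / (2 * κ))) * (4 * n⁻¹) :=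
        mul_le_mul (h1.trans h2) h3 (div_nonneg (by norm_num) (by linarith)) (by positivity)
    _ = 16 * (n ^ (-2 / (2 * κ)) * n⁻¹) := by ring
    _ ≤ _ := by linarith

/-- The selected set depends on the sample, so the error is dominated pointwise by a sum over all
candidates `S'`, each of which is then a fixed set to which independence and exchangeability apply.
-/
theorem lintegral_decoder_error_le {d κ n : ℕ} (hκ : 1 ≤ κ) (hn : 1 ≤ n) {pmin pmax : ℝ}
    (hp : 0 < pmin) {μ : Measure (Cube d)} (hμ : IsInputLaw pmin pmax μ) {L : ℝ≥0}
    {π : Cube κ → ℝ} (hπ : π ∈ lipschitzTargets κ L) (S : IndexSet d κ) (f : Decoder d n)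
    {A : Finset (Fin n)} (hA : n ≤ 2 * A.card) (hAc : n ≤ 2 * (Aᶜ.card + 1))
    (hf : ∀ data t, ∃ S : IndexSet d κ, ∃ j ∈ A, f.1 data t = (data j).2 ∧
        (∀ S' : IndexSet d κ, lipschitzScore S data ≤ lipschitzScore S' data) ∧
        ∀ b ∈ A, euclDist (reduce S (data j).1) (reduce S t) ≤
          euclDist (reduce S (data b).1) (reduce S t)) :
    ∫⁻ x : Fin (n + 1) → Cube d, ENNReal.ofReal ((π (reduce S (x (Fin.last n)))
          - f.1 (fun i : Fin n => (x i.castSucc, π (reduce S (x i.castSucc))))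
              (x (Fin.last n))) ^ 2) ∂(Measure.pi (fun _ : Fin (n + 1) => μ)) ≤
      ENNReal.ofReal (Fintype.card (IndexSet d κ) * (136 * κ * nnConst pmin d) * (L : ℝ) ^ 2 *
        (n : ℝ) ^ (-(2 : ℝ) / (κ : ℝ))) := by
  have hprob : IsProbabilityMeasure μ := hμ.1
  have hπm := measurable_of_mem_lipschitzTargets hπ
  have hn' : (1 : ℝ) ≤ n := by exact_mod_cast hn
  have hκ' : (1 : ℝ) ≤ κ := by exact_mod_cast hκ
  set A' := A.map Fin.castSuccEmb with hA'
  set B' := Aᶜ.map Fin.castSuccEmb with hB'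
  set t := Fin.last n with ht
  have htA : t ∉ A' := by simp [hA', ht]
  have htB : t ∉ B' := by simp [hB', ht]
  have hAB : Disjoint A' B' := (Finset.disjoint_map _).2 disjoint_compl_right
  have hca : (n : ℝ) / 2 ≤ (A'.card : ℝ) + 1 := by
    have : (n : ℝ) ≤ 2 * A.card := by exact_mod_cast hA
    rw [hA', Finset.card_map]
    linarith
  have hcb : (n : ℝ) / 2 ≤ (B'.card : ℝ) + 1 := by
    have : (n : ℝ) ≤ 2 * (Aᶜ.card + 1) := by exact_mod_cast hAc
    rw [hB', Finset.card_map]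
    linarith
  set ν := Measure.pi (fun _ : Fin (n + 1) => μ) with hν
  set c : ℝ := (L : ℝ) ^ 2 * κ with hc
  have hc0 : 0 ≤ c := by positivity
  set W : IndexSet d κ → (Fin (n + 1) → Cube d) → ℝ≥0∞ := fun S' =>
    (obstruction π L S S' A' t).indicator fun _ => 1 with hW
  set G : IndexSet d κ → (Fin (n + 1) → Cube d) → ℝ≥0∞ := fun S' x =>
    ENNReal.ofReal (2 * c) * (1 * ENNReal.ofReal (nnDist S'.1 A' t x ^ 2)) +
      ENNReal.ofReal (8 * c) * (W S' x * ENNReal.ofReal (nnDist (S.1 ∪ S'.1) B' t x ^ 2)) with hG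
  have hWm : ∀ S', Measurable (W S') := fun S' =>
    measurable_const.indicator (measurableSet_obstruction hπm L S S' A' t)
  have hm1 : ∀ (T : Finset (Fin d)) (B : Finset (Fin (n + 1))),
      Measurable fun x : Fin (n + 1) → Cube d => ENNReal.ofReal (nnDist T B t x ^ 2) :=
    fun T B => ((measurable_nnDist T B t).pow_const 2).ennreal_ofReal
  have hGm : ∀ S', Measurable (G S') := fun S' =>
    ((measurable_const.mul (hm1 _ _)).const_mul _).add (((hWm S').mul (hm1 _ _)).const_mul _)
  have hpt : ∀ x : Fin (n + 1) → Cube d, ENNReal.ofReal ((π (reduce S (x t))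
          - f.1 (fun i : Fin n => (x i.castSucc, π (reduce S (x i.castSucc)))) (x t)) ^ 2) ≤
      ∑ S', G S' x := by
    intro x
    obtain ⟨S', j, hj, hfj, hmin, hnn⟩ :=
      hf (fun i : Fin n => (x i.castSucc, π (reduce S (x i.castSucc)))) (x t)
    refine le_trans ?_ (Finset.single_le_sum (f := fun S' => G S' x) (fun _ _ => zero_le)
      (Finset.mem_univ S'))
    -- The true set `S` has score at most `L`, hence so has the minimiser `S'`.
    have hcons := (lipschitzScore_le_iff S' _ L).1
      ((hmin S).trans ((lipschitzScore_le_iff S _ L).2 fun i k => hπ _ _))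
    have hb := abs_sub_le_of_consistent hπ S S' (A := A') (B := B') (t := t) (x := x)
      (by
        intro i hi k hk
        rw [← Finset.map_union, Finset.union_compl, Finset.mem_map] at hi hk
        obtain ⟨i, -, rfl⟩ := hi
        obtain ⟨k, -, rfl⟩ := hk
        exact hcons i k) (j := j.castSucc) (Finset.mem_map_of_mem Fin.castSuccEmb hj)
      (by
        intro b hb
        obtain ⟨b, hbA, rfl⟩ := Finset.mem_map.1 hb
        exact hnn b hbA)
    rw [hfj]
    have hDA := nnDist_nonneg S'.1 A' t x
    have hDB := nnDist_nonneg (S.1 ∪ S'.1) B' t x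
    have hsq : ∀ D E : ℝ, (L * Real.sqrt κ * (D + 2 * E)) ^ 2 ≤
        2 * c * D ^ 2 + 8 * c * E ^ 2 := by
      intro D E
      rw [mul_pow, mul_pow, Real.sq_sqrt (Nat.cast_nonneg κ), ← hc]
      nlinarith [mul_nonneg hc0 (sq_nonneg (D - 2 * E))]
    by_cases hx : x ∈ obstruction π L S S' A' t
    · rw [Set.indicator_of_mem hx] at hb
      simp only [hG, hW, Set.indicator_of_mem hx, one_mul]
      rw [← ENNReal.ofReal_mul (by positivity), ← ENNReal.ofReal_mul (by positivity),
        ← ENNReal.ofReal_add (by positivity) (by positivity)]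
      refine ENNReal.ofReal_le_ofReal (le_trans ?_ (hsq _ _))
      exact sq_le_sq' (abs_le.1 hb).1 (abs_le.1 hb).2
    · rw [Set.indicator_of_notMem hx] at hb
      simp only [hG, hW, Set.indicator_of_notMem hx, one_mul, zero_mul, mul_zero, add_zero]
      rw [← ENNReal.ofReal_mul (by positivity)]
      refine ENNReal.ofReal_le_ofReal ?_
      have := hsq (nnDist S'.1 A' t x) 0
      rw [zero_pow two_ne_zero, mul_zero (8 * c), add_zero (2 * c * _)] at this
      exact le_trans (sq_le_sq' (abs_le.1 hb).1 (abs_le.1 hb).2) this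
  have hN1 := one_le_nnConst hp d
  set N := nnConst pmin d with hN
  set ρ := (n : ℝ) ^ (-(2 : ℝ) / (κ : ℝ)) with hρ
  have hρ0 : 0 ≤ ρ := by positivity
  have hint : ∀ S', ∫⁻ x, G S' x ∂ν ≤ ENNReal.ofReal (136 * κ * N * (L : ℝ) ^ 2 * ρ) := by
    intro S'
    have hI1 := lintegral_mul_nnDist_sq_le hμ hp (T := S'.1) (by rw [S'.2]; exact hκ) A' htA
      (W := fun _ => 1) measurable_const (fun _ _ => rfl)
    have hTle : (S.1 ∪ S'.1).card ≤ 2 * κ :=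
      (Finset.card_union_le _ _).trans (by rw [S.2, S'.2]; omega)
    have hTge : 1 ≤ (S.1 ∪ S'.1).card :=
      hκ.trans (S.2.symm.le.trans (Finset.card_le_card Finset.subset_union_left))
    have hI2 := lintegral_mul_nnDist_sq_le hμ hp (T := S.1 ∪ S'.1) hTge B' htB
      (hWm S') (fun x y => by
        have := obstruction_updateFinset_iff π L S S' hAB htB x y
        by_cases hx : x ∈ obstruction π L S S' A' t
        · simp only [hW, Set.indicator_of_mem hx, Set.indicator_of_mem (this.2 hx)]
        · simp only [hW, Set.indicator_of_notMem hx, Set.indicator_of_notMem (mt this.1 hx)])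
    have hW1 : ∫⁻ x, W S' x ∂ν ≤ ENNReal.ofReal (2 / ((A'.card : ℝ) + 1)) := by
      rw [lintegral_indicator_const (measurableSet_obstruction hπm L S S' A' t), one_mul]
      exact measure_obstruction_le μ hπm L S S' htA
    rw [lintegral_const, measure_univ, mul_one, mul_one, S'.2] at hI1
    have hI1' : ∫⁻ x, 1 * ENNReal.ofReal (nnDist S'.1 A' t x ^ 2) ∂ν ≤
        ENNReal.ofReal (N * (4 * ρ)) := by
      refine hI1.trans (ENNReal.ofReal_le_ofReal ?_)
      gcongr
      exact half_rpow_le hn' hκ' hca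
    have hI2' : ∫⁻ x, W S' x * ENNReal.ofReal (nnDist (S.1 ∪ S'.1) B' t x ^ 2) ∂ν ≤
        ENNReal.ofReal (N * (16 * ρ)) := by
      refine (hI2.trans (mul_le_mul_right hW1 _)).trans ?_
      rw [← ENNReal.ofReal_mul (by positivity), mul_assoc]
      refine ENNReal.ofReal_le_ofReal ?_
      refine mul_le_mul_of_nonneg_left ?_ (zero_le_one.trans hN1)
      exact rpow_mul_inv_le (m := ((S.1 ∪ S'.1).card : ℝ)) hn' hκ' (by exact_mod_cast hTge)
        (by exact_mod_cast hTle) hca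
        (by linarith [(Nat.cast_nonneg B'.card : (0 : ℝ) ≤ _)]) hcb
    have hma : Measurable fun x => 1 * ENNReal.ofReal (nnDist S'.1 A' t x ^ 2) :=
      (hm1 _ _).const_mul 1
    have hmb : Measurable fun x => W S' x * ENNReal.ofReal (nnDist (S.1 ∪ S'.1) B' t x ^ 2) :=
      (hWm S').mul (hm1 _ _)
    simp only [hG]
    rw [lintegral_add_left (hma.const_mul _), lintegral_const_mul _ hma,
      lintegral_const_mul _ hmb]
    refine (add_le_add (mul_le_mul_right hI1' _) (mul_le_mul_right hI2' _)).trans ?_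
    rw [← ENNReal.ofReal_mul (by positivity), ← ENNReal.ofReal_mul (by positivity),
      ← ENNReal.ofReal_add (by positivity) (by positivity)]
    -- The constant is `136 = 2 * 4 + 8 * 16`.
    refine ENNReal.ofReal_le_ofReal (le_of_eq ?_)
    rw [hc]
    ring
  calc _ ≤ ∫⁻ x, ∑ S', G S' x ∂ν := lintegral_mono hpt
    _ = ∑ S', ∫⁻ x, G S' x ∂ν := lintegral_finsetSum _ fun S' _ => hGm S'
    _ ≤ ∑ _S' : IndexSet d κ, ENNReal.ofReal (136 * κ * N * (L : ℝ) ^ 2 * ρ) :=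
        Finset.sum_le_sum fun S' _ => hint S'
    _ = _ := by
        rw [Finset.sum_const, nsmul_eq_mul, ← ENNReal.ofReal_natCast,
          ← ENNReal.ofReal_mul (by positivity), Finset.card_univ]
        congr 1
        ring

theorem iclRisk_le_of_forall {d κ n : ℕ} (hκ : κ ≤ d) {μ : Measure (Cube d)} {g : Cube d → Cube d}
    {π : Cube κ → ℝ} {f : Decoder d n} {K : ℝ≥0∞}
    (h : ∀ S : IndexSet d κ, ∫⁻ x : Fin (n + 1) → Cube d,
      ENNReal.ofReal ((π (reduce S (x (Fin.last n)))
          - f.1 (fun i : Fin n => (g (x i.castSucc), π (reduce S (x i.castSucc))))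
              (g (x (Fin.last n)))) ^ 2) ∂(Measure.pi (fun _ : Fin (n + 1) => μ)) ≤ K) :
    iclRisk μ g π f ≤ K := by
  unfold iclRisk
  have hpos : 0 < Fintype.card (IndexSet d κ) := by
    obtain ⟨S, -, hS⟩ := Finset.exists_subset_card_eq
      (s := (Finset.univ : Finset (Fin d))) (n := κ) (by simpa using hκ)
    exact Fintype.card_pos_iff.2 ⟨⟨S, hS⟩⟩
  rw [ENNReal.div_le_iff_le_mul (Or.inl (by exact_mod_cast hpos.ne'))
    (Or.inl (ENNReal.natCast_ne_top _))]
  calc _ ≤ ∑ _S : IndexSet d κ, K := Finset.sum_le_sum fun S _ => h S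
    _ = _ := by rw [Finset.sum_const, nsmul_eq_mul, mul_comm, Finset.card_univ]

theorem exists_decoder_adapting_to_coordinates (d κ : ℕ) (hκ : 1 ≤ κ) (hκd : κ ≤ d) :
    ∃ f : (n : ℕ) → Decoder d n,
      ∀ pmin pmax : ℝ, 0 < pmin →
        ∃ C : ℝ, 0 < C ∧
          ∀ μ : Measure (Cube d), IsInputLaw pmin pmax μ →
            ∀ (L : ℝ≥0) (n : ℕ), 1 ≤ n →
              (⨆ π ∈ lipschitzTargets κ L, iclRisk μ id π (f n)) ≤
                ENNReal.ofReal (C * (L : ℝ) ^ 2 * (n : ℝ) ^ (-(2 : ℝ) / (κ : ℝ))) := by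
  have hex : ∀ n : ℕ, ∃ f : Decoder d n, 1 ≤ n →
      ∃ A : Finset (Fin n), n ≤ 2 * A.card ∧ n ≤ 2 * (Aᶜ.card + 1) ∧
      ∀ data t, ∃ S : IndexSet d κ, ∃ j ∈ A, f.1 data t = (data j).2 ∧
        (∀ S' : IndexSet d κ, lipschitzScore S data ≤ lipschitzScore S' data) ∧
        ∀ b ∈ A, euclDist (reduce S (data j).1) (reduce S t) ≤
          euclDist (reduce S (data b).1) (reduce S t) := by
    intro n
    by_cases hn : 1 ≤ n
    · obtain ⟨f, hf⟩ := exists_nearestNeighbour_decoder d κ n hκd hn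
      exact ⟨f, fun _ => hf⟩
    -- A dummy for the empty sample, about which nothing is claimed.
    · exact ⟨⟨fun _ _ => 0, measurable_const⟩, fun h => absurd h hn⟩
  choose f hf using hex
  refine ⟨f, fun pmin pmax hp => ⟨Fintype.card (IndexSet d κ) * (136 * κ * nnConst pmin d) + 1,
    ?_, fun μ hμ L n hn => iSup₂_le fun π hπ => ?_⟩⟩
  · have := one_le_nnConst hp d
    positivity
  · obtain ⟨A, hA, hAc, hfA⟩ := hf n hn
    refine iclRisk_le_of_forall hκd fun S =>
      (lintegral_decoder_error_le hκ hn hp hμ hπ S (f n) hA hAc hfA).trans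
        (ENNReal.ofReal_le_ofReal ?_)
    gcongr
    exact le_add_of_nonneg_right zero_le_one

/-! ### Nearest neighbours in the encoded space -/

theorem exists_encoded_nearestNeighbour_decoder (d n : ℕ) (hn : 1 ≤ n) :
    ∃ f : Decoder d n, ∀ data t, ∃ j, f.1 data t = (data j).2 ∧
        ∀ b, euclDist (data j).1 t ≤ euclDist (data b).1 t := by
  have : Nonempty (Fin n) := ⟨⟨0, hn⟩⟩
  obtain ⟨m, hm, hm'⟩ := exists_measurable_argmin
    (fun (j : Fin n) (q : (Fin n → Cube d × ℝ) × Cube d) =>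
      ENNReal.ofReal (euclDist (q.1 j).1 q.2))
    fun j => (Measurable.euclDist (by fun_prop) (by fun_prop)).ennreal_ofReal
  refine ⟨⟨fun data t => (data (m (data, t))).2, measurable_select
    (F := fun (j : Fin n) (q : (Fin n → Cube d × ℝ) × Cube d) => (q.1 j).2) hm
    fun j => by fun_prop⟩, fun data t => ⟨m (data, t), rfl, fun b => ?_⟩⟩
  exact (ENNReal.ofReal_le_ofReal_iff (euclDist_nonneg _ _)).1 (hm' (data, t) b)

/-- Each of the two Lipschitz bounds on `g` costs one factor `L` in passing from the encoded nearest
neighbour to the true one; squaring gives `L ^ 4`. The label error is a coordinate difference, hence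
at most the distance. -/
theorem encoderMinimaxRisk_le (d : ℕ) (hd : 1 ≤ d) {L : ℝ≥0} (hL : 1 < L) {pmin pmax : ℝ}
    (hp : 0 < pmin) {μ : Measure (Cube d)} (hμ : IsInputLaw pmin pmax μ) {n : ℕ} (hn : 1 ≤ n) :
    encoderMinimaxRisk n L μ ≤
      ENNReal.ofReal (4 * (L : ℝ) ^ 4 * d * nnConst pmin d * (n : ℝ) ^ (-(2 : ℝ) / (d : ℝ))) := by
  have hprob : IsProbabilityMeasure μ := hμ.1
  have hn' : (1 : ℝ) ≤ n := by exact_mod_cast hn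
  have hd' : (1 : ℝ) ≤ d := by exact_mod_cast hd
  have hL' : (1 : ℝ) ≤ L := by exact_mod_cast hL.le
  have hL0 : (0 : ℝ) ≤ L := zero_le_one.trans hL'
  obtain ⟨f, hf⟩ := exists_encoded_nearestNeighbour_decoder d n hn
  refine iInf_le_of_le f (iSup₂_le fun g hg => iclRisk_le_of_forall hd fun S => ?_)
  set t := Fin.last n with ht
  set B : Finset (Fin (n + 1)) := Finset.univ.map Fin.castSuccEmb with hB
  have htB : t ∉ B := by simp [hB, ht]
  have hI := lintegral_mul_nnDist_sq_le hμ hp (T := Finset.univ) (by simpa using hd) B htB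
      (W := fun _ => ENNReal.ofReal ((L : ℝ) ^ 4 * d)) measurable_const (fun _ _ => rfl)
  rw [lintegral_const, measure_univ, mul_one, Finset.card_fin, hB, Finset.card_map,
    Finset.card_fin, ← hB] at hI
  have hN1 := one_le_nnConst hp d
  refine (lintegral_mono fun x => ?_).trans (hI.trans ?_)
  · obtain ⟨j, hfj, hnn⟩ :=
      hf (fun i : Fin n => (g (x i.castSucc), coordTarget (reduce S (x i.castSucc)))) (g (x t))
    rw [hfj, ← ENNReal.ofReal_mul (by positivity)]
    refine ENNReal.ofReal_le_ofReal ?_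
    have hD0 := nnDist_nonneg Finset.univ B t x
    set k := S.1.orderEmbOfFin S.2 0 with hk
    have key : |(x t k : ℝ) - x j.castSucc k| ≤
        (L : ℝ) ^ 2 * Real.sqrt d * nnDist Finset.univ B t x := by
      rcases nnDist_eq_one_or Finset.univ B t x with h | ⟨b, hb, h⟩
      · rw [h, mul_one]
        have h1 : |(x t k : ℝ) - x j.castSucc k| ≤ 1 :=
          abs_le.2 ⟨by linarith [(x j.castSucc k).2.2, (x t k).2.1],
            by linarith [(x j.castSucc k).2.1, (x t k).2.2]⟩
        exact h1.trans (one_le_mul_of_one_le_of_one_le (one_le_pow₀ hL')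
          (Real.one_le_sqrt.2 hd'))
      · obtain ⟨b, -, rfl⟩ := Finset.mem_map.1 hb
        calc |(x t k : ℝ) - x j.castSucc k| ≤ euclDist (x t) (x j.castSucc) :=
              abs_sub_le_euclDist _ _ _
          _ = euclDist (x j.castSucc) (x t) := euclDist_comm _ _
          _ ≤ L * euclDist (g (x j.castSucc)) (g (x t)) := (hg.2 _ _).2
          _ ≤ L * euclDist (g (x b.castSucc)) (g (x t)) := by gcongr; exact hnn b
          _ ≤ L * (L * euclDist (x b.castSucc) (x t)) := by gcongr; exact (hg.2 _ _).1
          _ ≤ L * (L * (Real.sqrt d * nnDist Finset.univ B t x)) := by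
              gcongr
              exact euclDist_le_of_abs_le hD0 fun i => h i (Finset.mem_univ i)
          _ = _ := by ring
    have hsq := sq_le_sq' (abs_le.1 key).1 (abs_le.1 key).2
    rw [mul_pow, mul_pow, Real.sq_sqrt (Nat.cast_nonneg d)] at hsq
    refine hsq.trans (le_of_eq ?_)
    ring
  · rw [← ENNReal.ofReal_mul (by positivity)]
    refine ENNReal.ofReal_le_ofReal ?_
    have h4 := half_rpow_le hn' hd' (show (n : ℝ) / 2 ≤ n + 1 by linarith)
    calc _ ≤ nnConst pmin d * (4 * (n : ℝ) ^ (-2 / (d : ℝ))) * ((L : ℝ) ^ 4 * d) := by gcongr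
      _ = _ := by ring

/-! ### A family of encoders perturbing small cells independently -/

/-- The centre of the cell with index `c` in the partition of the cube into `M ^ d` cells. -/
noncomputable def cellCenter {d M : ℕ} (c : Fin d → Fin M) : Fin d → ℝ :=
  fun i => ((c i : ℝ) + 1 / 2) / M

/-- Half the side length of a cell. -/
noncomputable def halfSide (M : ℕ) : ℝ := 1 / (2 * M)

/-- The open cell with index `c`. -/
def cell {d M : ℕ} (c : Fin d → Fin M) : Set (Cube d) :=
  {x | dist (fun i => (x i : ℝ)) (cellCenter c) < halfSide M}

/-- A tent function with a plateau, supported on the cell with index `c`. -/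
noncomputable def bump {d M : ℕ} (c : Fin d → Fin M) (x : Cube d) : ℝ :=
  max 0 (min (halfSide M / 4) (halfSide M - dist (fun i => (x i : ℝ)) (cellCenter c)))

/-- The superposition of the bumps with signs `σ`. -/
noncomputable def signedBumps {d M : ℕ} (σ : (Fin d → Fin M) → Bool) (x : Cube d) : ℝ :=
  ∑ c, (if σ c then 1 else -1) * bump c x

/-- The encoder that shifts the coordinate `k` by `ε` times the signed bumps. -/
noncomputable def perturb {d M : ℕ} (k : Fin d) (ε : ℝ) (σ : (Fin d → Fin M) → Bool)
    (x : Cube d) : Cube d :=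
  Function.update x k (Set.projIcc 0 1 zero_le_one ((x k : ℝ) + ε * signedBumps σ x))

theorem dist_val_le_euclDist {d : ℕ} (x y : Cube d) :
    dist (fun i => (x i : ℝ)) (fun i => (y i : ℝ)) ≤ euclDist x y :=
  (dist_pi_le_iff (euclDist_nonneg x y)).2 fun i => by
    rw [Real.dist_eq]
    exact abs_sub_le_euclDist x y i

section bump

variable {d M : ℕ}

theorem halfSide_pos (hM : 0 < M) : 0 < halfSide M := by unfold halfSide; positivity

theorem bump_eq_zero_of_notMem {c : Fin d → Fin M} {x : Cube d} (hx : x ∉ cell c) :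
    bump c x = 0 := by
  have : halfSide M ≤ dist (fun i => (x i : ℝ)) (cellCenter c) := not_lt.1 hx
  exact max_eq_left ((min_le_right _ _).trans (by linarith))

theorem bump_eq_of_dist_le {c : Fin d → Fin M} {x : Cube d} (hM : 0 < M)
    (hx : dist (fun i => (x i : ℝ)) (cellCenter c) ≤ 3 / 4 * halfSide M) :
    bump c x = halfSide M / 4 := by
  have := halfSide_pos hM
  unfold bump
  rw [min_eq_left (by linarith), max_eq_right (by linarith)]

theorem cell_index_unique {c c' : Fin d → Fin M} {x : Cube d} (h : x ∈ cell c)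
    (h' : x ∈ cell c') : c = c' := by
  funext i
  have hM : 0 < M := (Nat.zero_le _).trans_lt (c i).2
  have hM' : (0 : ℝ) < M := by exact_mod_cast hM
  have h1 := (dist_le_pi_dist _ _ i).trans_lt h
  have h2 := (dist_le_pi_dist _ _ i).trans_lt h'
  rw [Real.dist_eq, abs_lt] at h1 h2
  have e : halfSide M * M = 1 / 2 := by unfold halfSide; field_simp
  have e1 : cellCenter c i * M = c i + 1 / 2 := by unfold cellCenter; field_simp
  have e2 : cellCenter c' i * M = c' i + 1 / 2 := by unfold cellCenter; field_simp
  have h3 : ((c i : ℕ) : ℝ) < (c' i : ℕ) + 1 := by nlinarith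
  have h4 : ((c' i : ℕ) : ℝ) < (c i : ℕ) + 1 := by nlinarith
  have h5 : (c i : ℕ) < (c' i : ℕ) + 1 := by exact_mod_cast h3
  have h6 : (c' i : ℕ) < (c i : ℕ) + 1 := by exact_mod_cast h4
  exact Fin.ext (by omega)

theorem abs_bump_sub_le (c : Fin d → Fin M) (x y : Cube d) :
    |bump c x - bump c y| ≤ euclDist x y := by
  unfold bump
  have h : |dist (fun i => (x i : ℝ)) (cellCenter c) - dist (fun i => (y i : ℝ)) (cellCenter c)| ≤
      euclDist x y := (abs_dist_sub_le _ _ _).trans (dist_val_le_euclDist x y)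
  refine (abs_max_sub_max_le_max _ _ _ _).trans (max_le (by simpa using euclDist_nonneg x y) ?_)
  refine (abs_min_sub_min_le_max _ _ _ _).trans (max_le (by simpa using euclDist_nonneg x y) ?_)
  rwa [sub_sub_sub_cancel_left, abs_sub_comm]

/-- The cells are disjoint, so at most one bump is nonzero at `x` and at most one at `y`, and each
bump is 1-Lipschitz. -/
theorem abs_signedBumps_sub_le (σ : (Fin d → Fin M) → Bool) (x y : Cube d) :
    |signedBumps σ x - signedBumps σ y| ≤ 2 * euclDist x y := by
  classical
  unfold signedBumps
  rw [← Finset.sum_sub_distrib]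
  have hterm : ∀ c, |(if σ c then (1 : ℝ) else -1) * bump c x - (if σ c then 1 else -1) * bump c y|
      ≤ euclDist x y := by
    intro c
    rw [← mul_sub, abs_mul]
    have : |(if σ c then (1 : ℝ) else -1)| = 1 := by split_ifs <;> simp
    rw [this, one_mul]
    exact abs_bump_sub_le c x y
  set Q : Finset (Fin d → Fin M) := Finset.univ.filter (fun c => x ∈ cell c) ∪
    Finset.univ.filter (fun c => y ∈ cell c) with hQ
  have hcard : Q.card ≤ 2 := by
    have hone : ∀ u : Cube d, (Finset.univ.filter
        (fun c : Fin d → Fin M => u ∈ cell c)).card ≤ 1 := fun u =>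
      Finset.card_le_one.2 fun a ha b hb => by
        simp only [Finset.mem_filter, Finset.mem_univ, true_and] at ha hb
        exact cell_index_unique ha hb
    have hux := hone x
    have huy := hone y
    exact (Finset.card_union_le _ _).trans (by omega)
  rw [← Finset.sum_subset (Finset.subset_univ Q)]
  · refine (Finset.abs_sum_le_sum_abs _ _).trans ((Finset.sum_le_sum fun c _ => hterm c).trans ?_)
    rw [Finset.sum_const, nsmul_eq_mul]
    exact mul_le_mul_of_nonneg_right (by exact_mod_cast hcard) (euclDist_nonneg _ _)
  · intro c _ hc
    simp only [hQ, Finset.mem_union, Finset.mem_filter, Finset.mem_univ, true_and, not_or] at hc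
    rw [bump_eq_zero_of_notMem hc.1, bump_eq_zero_of_notMem hc.2]
    simp

theorem notMem_cell_of_boundary (c : Fin d → Fin M) (x : Cube d) {k : Fin d}
    (hx : x k = 0 ∨ x k = 1) : x ∉ cell c := by
  intro h
  have hM : 0 < M := (Nat.zero_le _).trans_lt (c k).2
  have hM' : (0 : ℝ) < M := by exact_mod_cast hM
  have h1 := (dist_le_pi_dist _ _ k).trans_lt h
  rw [Real.dist_eq, abs_lt] at h1
  have e : halfSide M * M = 1 / 2 := by unfold halfSide; field_simp
  have e1 : cellCenter c k * M = c k + 1 / 2 := by unfold cellCenter; field_simp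
  have h2 : ((c k : ℕ) : ℝ) + 1 ≤ M := by exact_mod_cast (c k).2
  have h3 : (0 : ℝ) ≤ (c k : ℕ) := Nat.cast_nonneg _
  rcases hx with hx | hx <;> rw [hx] at h1
  · simp only [Set.Icc.coe_zero] at h1
    nlinarith
  · simp only [Set.Icc.coe_one] at h1
    nlinarith

theorem signedBumps_eq_zero_of_boundary (σ : (Fin d → Fin M) → Bool) (x : Cube d) {k : Fin d}
    (hx : x k = 0 ∨ x k = 1) : signedBumps σ x = 0 :=
  Finset.sum_eq_zero fun c _ => by
    rw [bump_eq_zero_of_notMem (notMem_cell_of_boundary c x hx), mul_zero]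

theorem signedBumps_of_mem_cell (σ : (Fin d → Fin M) → Bool) {c : Fin d → Fin M} {x : Cube d}
    (hx : x ∈ cell c) : signedBumps σ x = (if σ c then 1 else -1) * bump c x := by
  unfold signedBumps
  refine Finset.sum_eq_single c (fun c' _ hne => ?_) (fun h => absurd (Finset.mem_univ c) h)
  rw [bump_eq_zero_of_notMem fun h => hne (cell_index_unique h hx), mul_zero]

theorem signedBumps_congr {σ σ' : (Fin d → Fin M) → Bool} {x : Cube d}
    (h : ∀ c, x ∈ cell c → σ c = σ' c) : signedBumps σ x = signedBumps σ' x := by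
  refine Finset.sum_congr rfl fun c _ => ?_
  by_cases hc : x ∈ cell c
  · rw [h c hc]
  · rw [bump_eq_zero_of_notMem hc, mul_zero, mul_zero]

theorem euclDist_update (x : Cube d) (k : Fin d) (s : unitInterval) :
    euclDist x (Function.update x k s) = |(x k : ℝ) - s| := by
  unfold euclDist
  rw [Finset.sum_eq_single k, Function.update_self, Real.sqrt_sq_eq_abs]
  · intro i _ hi
    simp [hi]
  · simp

theorem continuous_signedBumps (σ : (Fin d → Fin M) → Bool) : Continuous (signedBumps σ) := by
  unfold signedBumps bump
  fun_prop

/-- The clamp is inactive: the signed bumps vanish on the two faces orthogonal to `k` and are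
2-Lipschitz, so `ε ≤ 1 / 2` makes the shift no larger than the distance to either face. -/
theorem coe_perturb (k : Fin d) {ε : ℝ} (hε0 : 0 ≤ ε) (hε : ε ≤ 1 / 2)
    (σ : (Fin d → Fin M) → Bool) (x : Cube d) :
    (perturb k ε σ x k : ℝ) = x k + ε * signedBumps σ x := by
  have h0 := abs_signedBumps_sub_le σ x (Function.update x k 0)
  have h1 := abs_signedBumps_sub_le σ x (Function.update x k 1)
  rw [signedBumps_eq_zero_of_boundary σ (Function.update x k 0) (k := k) (Or.inl (by simp)),
    euclDist_update, sub_zero] at h0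
  rw [signedBumps_eq_zero_of_boundary σ (Function.update x k 1) (k := k) (Or.inr (by simp)),
    euclDist_update, sub_zero] at h1
  have hx0 := (x k).2.1
  have hx1 := (x k).2.2
  simp only [Set.Icc.coe_zero, Set.Icc.coe_one] at h0 h1
  rw [sub_zero, abs_of_nonneg hx0, abs_le] at h0
  rw [abs_of_nonpos (a := (x k : ℝ) - 1) (by linarith), abs_le] at h1
  have hmem : (x k : ℝ) + ε * signedBumps σ x ∈ Set.Icc (0 : ℝ) 1 :=
    ⟨by nlinarith, by nlinarith⟩
  unfold perturb
  rw [Function.update_self, Set.projIcc_of_mem zero_le_one hmem]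

theorem perturb_of_ne {k i : Fin d} (hi : i ≠ k) (ε : ℝ) (σ : (Fin d → Fin M) → Bool)
    (x : Cube d) : perturb k ε σ x i = x i := by
  unfold perturb
  rw [Function.update_of_ne hi]

theorem continuous_perturb (k : Fin d) (ε : ℝ) (σ : (Fin d → Fin M) → Bool) :
    Continuous (perturb k ε σ : Cube d → Cube d) := by
  unfold perturb
  refine continuous_id.update k (continuous_projIcc.comp ?_)
  have := continuous_signedBumps σ
  fun_prop

/-- The two difference vectors differ by `δ` times a unit vector, so the reverse triangle inequality
applies. -/
theorem abs_euclDist_sub_le {x y x' y' : Cube d} {k : Fin d} {δ : ℝ}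
    (hk : (x' k : ℝ) - y' k = x k - y k + δ)
    (h : ∀ i, i ≠ k → (x' i : ℝ) - y' i = x i - y i) :
    |euclDist x' y' - euclDist x y| ≤ |δ| := by
  simp only [euclDist_eq_dist, dist_eq_norm]
  refine (abs_norm_sub_norm_le _ _).trans (le_of_eq ?_)
  have : (WithLp.toLp 2 (fun i => (x' i : ℝ)) - WithLp.toLp 2 (fun i => (y' i : ℝ)) -
      (WithLp.toLp 2 (fun i => (x i : ℝ)) - WithLp.toLp 2 (fun i => (y i : ℝ))) :
      EuclideanSpace ℝ (Fin d)) = EuclideanSpace.single k δ := by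
    ext i
    rcases eq_or_ne i k with rfl | hi
    · simp [hk]
    · simp [hi, h i hi]
  rw [this, PiLp.norm_single, Real.norm_eq_abs]

/-- The displacement is `2 * ε`-Lipschitz with `2 * ε ≤ 1 - 1 / L`, so distances are scaled by
factors between `1 / L` and `2 - 1 / L`, and the latter is at most `L`. -/
theorem perturb_mem_biLipschitzEncoders (k : Fin d) {L : ℝ≥0} (hL : 1 < L)
    {ε : ℝ} (hε0 : 0 ≤ ε) (hε : ε ≤ (1 - 1 / L) / 2) (σ : (Fin d → Fin M) → Bool) :
    perturb k ε σ ∈ biLipschitzEncoders d L := by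
  have hL' : (1 : ℝ) < L := by exact_mod_cast hL
  have hinv : 0 < 1 / (L : ℝ) := by positivity
  have hLinv : (L : ℝ) * (1 / L) = 1 := by field_simp
  have hε2 : ε ≤ 1 / 2 := by linarith
  have hlip : ∀ x y, |euclDist (perturb k ε σ x) (perturb k ε σ y) - euclDist x y| ≤
      (1 - 1 / L) * euclDist x y := by
    intro x y
    refine (abs_euclDist_sub_le (k := k) (δ := ε * (signedBumps σ x - signedBumps σ y))
      ?_ ?_).trans ?_
    · rw [coe_perturb k hε0 hε2, coe_perturb k hε0 hε2]
      ring
    · intro i hi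
      rw [perturb_of_ne hi, perturb_of_ne hi]
    · rw [abs_mul, abs_of_nonneg hε0]
      calc ε * |signedBumps σ x - signedBumps σ y| ≤ (1 - 1 / L) / 2 * (2 * euclDist x y) :=
            mul_le_mul hε (abs_signedBumps_sub_le σ x y) (abs_nonneg _) (by linarith)
        _ = _ := by ring
  have hbi : ∀ x y, euclDist (perturb k ε σ x) (perturb k ε σ y) ≤ L * euclDist x y ∧
      euclDist x y ≤ L * euclDist (perturb k ε σ x) (perturb k ε σ y) := by
    intro x y
    have h := abs_le.1 (hlip x y)
    have h0 := euclDist_nonneg x y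
    constructor
    · have : (2 - 1 / (L : ℝ)) ≤ L := by nlinarith
      nlinarith
    · have : 1 / (L : ℝ) * euclDist x y ≤ euclDist (perturb k ε σ x) (perturb k ε σ y) := by
        linarith
      calc euclDist x y = L * (1 / L * euclDist x y) := by rw [← mul_assoc, hLinv, one_mul]
        _ ≤ _ := mul_le_mul_of_nonneg_left this L.coe_nonneg
  refine ⟨⟨fun x y hxy => ?_, fun z => ?_⟩, hbi⟩
  · have h := (hbi x y).2
    rw [hxy, show euclDist (perturb k ε σ y) (perturb k ε σ y) = 0 by simp [euclDist],
      mul_zero] at h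
    funext i
    refine Subtype.ext (sub_eq_zero.1 (abs_eq_zero.1 (le_antisymm ?_ (abs_nonneg _))))
    exact (abs_sub_le_euclDist x y i).trans h
  · have hcont : Continuous fun s : unitInterval =>
        (s : ℝ) + ε * signedBumps σ (Function.update z k s) := by
      have := (continuous_signedBumps σ).comp
        ((continuous_const (y := z)).update k (continuous_id (X := unitInterval)))
      exact continuous_subtype_val.add (continuous_const.mul this)
    -- Surjectivity by the intermediate value theorem on the line through `z` in direction `k`,
    -- whose endpoints are fixed because the bumps vanish there.
    obtain ⟨s, hs⟩ := mem_range_of_exists_le_of_exists_ge hcont (c := (z k : ℝ))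
      ⟨0, by
        rw [signedBumps_eq_zero_of_boundary σ (Function.update z k 0) (k := k) (Or.inl (by simp))]
        simpa using (z k).2.1⟩
      ⟨1, by
        rw [signedBumps_eq_zero_of_boundary σ (Function.update z k 1) (k := k) (Or.inr (by simp))]
        simpa using (z k).2.2⟩
    refine ⟨Function.update z k s, funext fun i => ?_⟩
    rcases eq_or_ne i k with rfl | hi
    · refine Subtype.ext ?_
      rw [coe_perturb i hε0 hε2, Function.update_self]
      exact hs
    · rw [perturb_of_ne hi, Function.update_of_ne hi]

end bump

/-! ### Translations of boxes inside the cube -/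

/-- Translation by `v`, clamped to the cube. -/
noncomputable def shift {d : ℕ} (v : Fin d → ℝ) (x : Cube d) : Cube d :=
  fun i => Set.projIcc 0 1 zero_le_one ((x i : ℝ) + v i)

/-- The box with centre `a` and half side `h`. -/
def box {d : ℕ} (a : Fin d → ℝ) (h : ℝ) : Set (Cube d) :=
  Set.pi Set.univ fun i => {s : unitInterval | |(s : ℝ) - a i| ≤ h}

theorem measurableSet_box {d : ℕ} (a : Fin d → ℝ) (h : ℝ) : MeasurableSet (box a h) :=
  MeasurableSet.univ_pi fun i => measurableSet_abs_sub_le (a i) h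

/-- The hypotheses keep both intervals inside `[0, 1]`, so the clamped map is an honest translation
between them. -/
theorem measurePreserving_clampedAdd {a h v : ℝ} (h0 : h ≤ a) (h1 : a + h ≤ 1)
    (h2 : h ≤ a - v) (h3 : a - v + h ≤ 1) :
    MeasurePreserving
      (fun s : unitInterval => (Set.projIcc 0 1 zero_le_one ((s : ℝ) + v) : unitInterval))
      (volume.restrict {s : unitInterval | |(s : ℝ) - (a - v)| ≤ h})
      (volume.restrict {s : unitInterval | |(s : ℝ) - a| ≤ h}) := by
  have hm : Measurable
      (fun s : unitInterval => (Set.projIcc 0 1 zero_le_one ((s : ℝ) + v) : unitInterval)) :=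
    (continuous_projIcc.comp (by fun_prop)).measurable
  refine ⟨hm, ?_⟩
  ext E hE
  rw [Measure.map_apply hm hE, Measure.restrict_apply (hm hE), Measure.restrict_apply hE,
    unitInterval.volume_apply, unitInterval.volume_apply, ← measure_preimage_add_right volume v
      (Subtype.val '' (E ∩ {s : unitInterval | |(s : ℝ) - a| ≤ h}))]
  congr 1
  ext u
  simp only [Set.mem_image, Set.mem_inter_iff, Set.mem_preimage, Set.mem_ofPred_eq]
  constructor
  · rintro ⟨s, ⟨hsE, hs⟩, rfl⟩
    have hs' := abs_le.1 hs
    have hmem : (s : ℝ) + v ∈ Set.Icc (0 : ℝ) 1 := ⟨by linarith, by linarith⟩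
    rw [Set.projIcc_of_mem zero_le_one hmem] at hsE
    exact ⟨⟨(s : ℝ) + v, hmem⟩, ⟨hsE, by rwa [sub_sub_eq_add_sub] at hs⟩, rfl⟩
  · rintro ⟨s, ⟨hsE, hs⟩, hsu⟩
    have hs' := abs_le.1 hs
    have hmem : u ∈ Set.Icc (0 : ℝ) 1 := ⟨by linarith, by linarith⟩
    refine ⟨⟨u, hmem⟩, ⟨?_, ?_⟩, rfl⟩
    · have : (Set.projIcc 0 1 zero_le_one (u + v) : unitInterval) = s := by
        rw [← hsu, Set.projIcc_val]
      change Set.projIcc 0 1 zero_le_one (u + v) ∈ E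
      rw [this]
      exact hsE
    · change |u - (a - v)| ≤ h
      rw [hsu] at hs
      rwa [sub_sub_eq_add_sub]

theorem measurePreserving_shift {d : ℕ} {a v : Fin d → ℝ} {h : ℝ} (h0 : ∀ i, h ≤ a i)
    (h1 : ∀ i, a i + h ≤ 1) (h2 : ∀ i, h ≤ a i - v i) (h3 : ∀ i, a i - v i + h ≤ 1) :
    MeasurePreserving (shift v) (volume.restrict (box (fun i => a i - v i) h))
      (volume.restrict (box a h)) := by
  unfold box
  rw [volume_pi, Measure.restrict_pi_pi, Measure.restrict_pi_pi]
  exact measurePreserving_pi _ _ fun i =>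
    measurePreserving_clampedAdd (h0 i) (h1 i) (h2 i) (h3 i)

theorem ofReal_pow_le_volume_box {d : ℕ} {a : Fin d → ℝ} {h : ℝ} (hh0 : 0 ≤ h) (hh : h ≤ 1)
    (ha : ∀ i, a i ∈ Set.Icc (0 : ℝ) 1) : ENNReal.ofReal (h ^ d) ≤ volume (box a h) := by
  unfold box
  have hconst : ENNReal.ofReal (h ^ d) = ∏ _i : Fin d, ENNReal.ofReal h := by
    rw [ENNReal.ofReal_pow hh0, Finset.prod_const, Finset.card_fin]
  rw [volume_pi, Measure.pi_pi, hconst]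
  exact Finset.prod_le_prod' fun i _ => ofReal_le_volume_abs_sub_le ⟨a i, ha i⟩ hh0 hh

theorem IsInputLaw.smul_volume_le {d : ℕ} {pmin pmax : ℝ} {μ : Measure (Cube d)}
    (h : IsInputLaw pmin pmax μ) : ENNReal.ofReal pmin • (volume : Measure (Cube d)) ≤ μ :=
  Measure.le_iff.2 fun s hs => by
    simpa using h.le_apply hs

/-! ### Two encoders differing in one cell -/

section cell

variable {d M : ℕ}

theorem halfSide_le_cellCenter (c : Fin d → Fin M) (i : Fin d) :
    halfSide M ≤ cellCenter c i ∧ cellCenter c i + halfSide M ≤ 1 := by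
  have hM : 0 < M := (Nat.zero_le _).trans_lt (c i).2
  have hM' : (0 : ℝ) < M := by exact_mod_cast hM
  have e : halfSide M * M = 1 / 2 := by unfold halfSide; field_simp
  have e1 : cellCenter c i * M = c i + 1 / 2 := by unfold cellCenter; field_simp
  have h2 : ((c i : ℕ) : ℝ) + 1 ≤ M := by exact_mod_cast (c i).2
  have h3 : (0 : ℝ) ≤ (c i : ℕ) := Nat.cast_nonneg _
  constructor
  · refine le_of_mul_le_mul_right ?_ hM'
    rw [e, e1]
    linarith
  · refine le_of_mul_le_mul_right ?_ hM'
    rw [add_mul, e, e1]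
    linarith

theorem measurableSet_cell (c : Fin d → Fin M) : MeasurableSet (cell c : Set (Cube d)) := by
  have : Continuous fun x : Cube d => dist (fun i => (x i : ℝ)) (cellCenter c) := by fun_prop
  exact measurableSet_lt this.measurable measurable_const

/-- On the plateau of the bump the encoder is a translation by `s * δ` along `k`. Changing variables
to the encoded point `z` gives an integral over a box that does not depend on the sign, so the two
signs can be compared at the same `z`. -/
theorem setLIntegral_cell_ge (hM : 0 < M) (k : Fin d) {ε : ℝ} (hε0 : 0 ≤ ε) (hε : ε ≤ 1 / 2)
    (σ : (Fin d → Fin M) → Bool) (c : Fin d → Fin M) {F : Cube d → ℝ} (hF : Measurable F)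
    {s : ℝ} (hs : s = if σ c then 1 else -1) :
    ∫⁻ z in box (cellCenter c) (halfSide M / 2),
        ENNReal.ofReal (((z k : ℝ) - s * (ε * (halfSide M / 4)) - F z) ^ 2) ≤
      ∫⁻ x in cell c, ENNReal.ofReal (((x k : ℝ) - F (perturb k ε σ x)) ^ 2) := by
  have hw := halfSide_pos hM
  set w := halfSide M with hw'
  set δ := ε * (w / 4) with hδ
  have hδ0 : 0 ≤ δ := by positivity
  have hδw : δ ≤ w / 8 := by rw [hδ]; nlinarith
  have hsδ : |s * δ| ≤ w / 8 := by
    have : |s| = 1 := by rw [hs]; split_ifs <;> simp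
    rw [abs_mul, this, one_mul, abs_of_nonneg hδ0]
    exact hδw
  set v : Fin d → ℝ := fun i => if i = k then s * δ else 0 with hv
  have hvle : ∀ i, |v i| ≤ w / 8 := by
    intro i
    simp only [hv]
    split_ifs
    · exact hsδ
    · simpa using by positivity
  have hmp : MeasurePreserving (shift v)
      (volume.restrict (box (fun i => cellCenter c i - v i) (w / 2)))
      (volume.restrict (box (cellCenter c) (w / 2))) := by
    refine measurePreserving_shift ?_ ?_ ?_ ?_ <;>
    · intro i
      have h1 := halfSide_le_cellCenter c i
      have h2 := abs_le.1 (hvle i)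
      rw [← hw'] at h1
      linarith [h1.1, h1.2, h2.1, h2.2]
  have hH : Measurable fun z : Cube d => ENNReal.ofReal (((z k : ℝ) - s * δ - F z) ^ 2) := by
    fun_prop
  rw [← hmp.lintegral_comp hH]
  -- The translated box reaches at most `w / 2 + w / 8` from the centre, within the plateau radius
  -- `3 / 4 * w`.
  have hdist : ∀ x ∈ box (fun i => cellCenter c i - v i) (w / 2),
      dist (fun i => (x i : ℝ)) (cellCenter c) ≤ 3 / 4 * w := by
    intro x hx
    refine (dist_pi_le_iff (by positivity)).2 fun i => ?_
    have h1 : |(x i : ℝ) - (cellCenter c i - v i)| ≤ w / 2 := hx i trivial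
    have h2 := abs_le.1 (hvle i)
    have h1 := abs_le.1 h1
    rw [Real.dist_eq]
    exact abs_le.2 ⟨by linarith [h1.1, h2.2], by linarith [h1.2, h2.1]⟩
  have hcell : ∀ x ∈ box (fun i => cellCenter c i - v i) (w / 2), x ∈ cell c := by
    intro x hx
    exact (hdist x hx).trans_lt (by linarith)
  refine le_trans (le_of_eq ?_) (lintegral_mono_set (μ := volume) hcell)
  refine setLIntegral_congr_fun (measurableSet_box _ _) fun x hx => ?_
  have hb : signedBumps σ x = s * (w / 4) := by
    rw [signedBumps_of_mem_cell σ (hcell x hx), bump_eq_of_dist_le hM (hdist x hx), hs]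
  have hshift : perturb k ε σ x = shift v x := by
    funext i
    rcases eq_or_ne i k with rfl | hi
    · unfold perturb shift
      rw [Function.update_self, hb]
      congr 2
      simp only [hv, if_true, hδ]
      ring
    · rw [perturb_of_ne hi]
      unfold shift
      simp only [hv, if_neg hi, add_zero]
      rw [Set.projIcc_val]
  have hk : (shift v x k : ℝ) = x k + s * δ := by
    rw [← hshift, coe_perturb k hε0 hε, hb, hδ]
    ring
  rw [hk, hshift, add_sub_cancel_right]

/-- No prediction can do well for both of two encoders with opposite signs in a cell. -/
theorem le_setLIntegral_cell_add {pmin pmax : ℝ} (hp : 0 < pmin) {μ : Measure (Cube d)}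
    (hμ : IsInputLaw pmin pmax μ) (hM : 0 < M) (k : Fin d) {ε : ℝ} (hε0 : 0 ≤ ε)
    (hε : ε ≤ 1 / 2) {σ σ' : (Fin d → Fin M) → Bool} {c : Fin d → Fin M}
    (hσ : σ' c = !σ c) {F : Cube d → ℝ} (hF : Measurable F) :
    ENNReal.ofReal (pmin * ((halfSide M / 2) ^ d * (2 * (ε * (halfSide M / 4)) ^ 2))) ≤
      ∫⁻ x in cell c, ENNReal.ofReal (((x k : ℝ) - F (perturb k ε σ x)) ^ 2) ∂μ +
      ∫⁻ x in cell c, ENNReal.ofReal (((x k : ℝ) - F (perturb k ε σ' x)) ^ 2) ∂μ := by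
  have hw := halfSide_pos hM
  set w := halfSide M with hw'
  set δ := ε * (w / 4) with hδ
  set s : ℝ := if σ c then 1 else -1 with hs
  have hs' : -s = if σ' c then 1 else -1 := by
    rw [hs, hσ]
    cases σ c <;> simp
  have h1 := setLIntegral_cell_ge hM k hε0 hε σ c hF hs
  have h2 := setLIntegral_cell_ge hM k hε0 hε σ' c hF hs'
  rw [← hw', ← hδ] at h1 h2
  have hle : ∀ G : Cube d → ℝ≥0∞,
      ENNReal.ofReal pmin * ∫⁻ x in cell c, G x ≤ ∫⁻ x in cell c, G x ∂μ := by
    intro G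
    rw [← smul_eq_mul, ← lintegral_smul_measure, ← Measure.restrict_smul]
    exact lintegral_mono' (Measure.restrict_mono le_rfl hμ.smul_volume_le) le_rfl
  refine le_trans ?_ (add_le_add (hle _) (hle _))
  rw [← mul_add, ENNReal.ofReal_mul hp.le]
  gcongr
  refine le_trans ?_ (add_le_add h1 h2)
  have hm : Measurable fun z : Cube d => ENNReal.ofReal (((z k : ℝ) - s * δ - F z) ^ 2) := by
    fun_prop
  rw [← lintegral_add_left hm]
  have hvol : ENNReal.ofReal ((w / 2) ^ d) ≤ volume (box (cellCenter c) (w / 2)) := by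
    by_cases hd : Nonempty (Fin d)
    · obtain ⟨i⟩ := hd
      have hi := halfSide_le_cellCenter c i
      refine ofReal_pow_le_volume_box (by positivity) (by rw [← hw'] at hi; linarith) fun i => ?_
      have hi := halfSide_le_cellCenter c i
      rw [← hw'] at hi
      exact ⟨by linarith, by linarith⟩
    · exact absurd ⟨k⟩ hd
  calc ENNReal.ofReal ((w / 2) ^ d * (2 * δ ^ 2))
      = ENNReal.ofReal (2 * δ ^ 2) * ENNReal.ofReal ((w / 2) ^ d) := by
        rw [mul_comm, ENNReal.ofReal_mul (by positivity)]
    _ ≤ ENNReal.ofReal (2 * δ ^ 2) * volume (box (cellCenter c) (w / 2)) := by gcongr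
    _ = ∫⁻ _z in box (cellCenter c) (w / 2), ENNReal.ofReal (2 * δ ^ 2) := by
        rw [setLIntegral_const]
    _ ≤ _ := by
        refine lintegral_mono fun z => ?_
        rw [← ENNReal.ofReal_add (by positivity) (by positivity)]
        refine ENNReal.ofReal_le_ofReal ?_
        have hss : s ^ 2 = 1 := by rw [hs]; split_ifs <;> norm_num
        have : s ^ 2 * δ ^ 2 = δ ^ 2 := by rw [hss, one_mul]
        -- Parallelogram identity: the two possible labels at `z` are `2 * δ` apart, so the squared
        -- errors of a single prediction sum to at least `2 * δ ^ 2`.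
        have hid : ((z k : ℝ) - s * δ - F z) ^ 2 + ((z k : ℝ) - -s * δ - F z) ^ 2 =
            2 * ((z k : ℝ) - F z) ^ 2 + 2 * (s ^ 2 * δ ^ 2) := by ring
        linarith [sq_nonneg ((z k : ℝ) - F z)]

end cell

/-! ### The lower bound -/

theorem volume_abs_sub_le_le (a h : ℝ) :
    volume {s : unitInterval | |(s : ℝ) - a| ≤ h} ≤ ENNReal.ofReal (2 * h) := by
  rw [unitInterval.volume_apply]
  have : Subtype.val '' {s : unitInterval | |(s : ℝ) - a| ≤ h} ⊆ Set.Icc (a - h) (a + h) := by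
    rintro _ ⟨s, hs, rfl⟩
    have := abs_le.1 (show |(s : ℝ) - a| ≤ h from hs)
    exact ⟨by linarith, by linarith⟩
  refine (measure_mono this).trans (le_of_eq ?_)
  rw [Real.volume_Icc]
  congr 1
  ring

section lower

variable {d M n : ℕ}

theorem volume_cell_le (hM : 0 < M) (c : Fin d → Fin M) :
    volume (cell c : Set (Cube d)) ≤ ENNReal.ofReal ((1 / (M : ℝ)) ^ d) := by
  have hsub : (cell c : Set (Cube d)) ⊆ box (cellCenter c) (halfSide M) := by
    intro x hx i _
    have := (dist_le_pi_dist _ _ i).trans (le_of_lt hx)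
    rwa [Real.dist_eq] at this
  have e : 2 * halfSide M = 1 / (M : ℝ) := by
    have : (0 : ℝ) < M := by exact_mod_cast hM
    unfold halfSide
    field_simp
  refine (measure_mono hsub).trans ?_
  unfold box
  rw [volume_pi, Measure.pi_pi, ENNReal.ofReal_pow (by positivity), ← e]
  refine (Finset.prod_le_prod' fun i _ => volume_abs_sub_le_le _ _).trans (le_of_eq ?_)
  rw [Finset.prod_const, Finset.card_fin]

/-- The event that none of the sample points lies in the cell with index `c`. -/
def avoidCell (c : Fin d → Fin M) : Set (Fin n → Cube d) := {y | ∀ i, y i ∉ cell c}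

theorem measurableSet_avoidCell (c : Fin d → Fin M) :
    MeasurableSet (avoidCell c : Set (Fin n → Cube d)) := by
  have : (avoidCell c : Set (Fin n → Cube d)) = ⋂ i, (fun y => y i) ⁻¹' (cell c)ᶜ := by
    ext y; simp [avoidCell]
  rw [this]
  exact MeasurableSet.iInter fun i => measurable_pi_apply i (measurableSet_cell c).compl

/-- Union bound: each of the `n` points hits the cell with probability at most `pmax / M ^ d`. -/
theorem half_le_measure_avoidCell {pmin pmax : ℝ} {μ : Measure (Cube d)}
    (hμ : IsInputLaw pmin pmax μ) (hM : 0 < M) (hn : 2 * n * pmax ≤ (M : ℝ) ^ d)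
    (c : Fin d → Fin M) :
    2⁻¹ ≤ Measure.pi (fun _ : Fin n => μ) (avoidCell c) := by
  have hprob : IsProbabilityMeasure μ := hμ.1
  have hM' : (0 : ℝ) < M := by exact_mod_cast hM
  have hcompl : Measure.pi (fun _ : Fin n => μ) (avoidCell c)ᶜ ≤ 2⁻¹ := by
    have hset : (avoidCell c : Set (Fin n → Cube d))ᶜ = ⋃ i, (Function.eval i) ⁻¹' (cell c) := by
      ext y; simp [avoidCell]
    rw [hset]
    have hi : ∀ i : Fin n, Measure.pi (fun _ : Fin n => μ) (Function.eval i ⁻¹' (cell c)) =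
        μ (cell c) := fun i =>
      (measurePreserving_eval (fun _ : Fin n => μ) i).measure_preimage
        (measurableSet_cell c).nullMeasurableSet
    calc _ ≤ ∑ i : Fin n, Measure.pi (fun _ : Fin n => μ) (Function.eval i ⁻¹' (cell c)) :=
          measure_iUnion_fintype_le _ _
      _ = n * μ (cell c) := by
          rw [Finset.sum_congr rfl fun i _ => hi i, Finset.sum_const, Finset.card_fin,
            nsmul_eq_mul]
      _ ≤ n * (ENNReal.ofReal pmax * ENNReal.ofReal ((1 / (M : ℝ)) ^ d)) := by
          gcongr
          exact (hμ.apply_le (measurableSet_cell c)).trans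
            (mul_le_mul_right (volume_cell_le hM c) _)
      _ = ENNReal.ofReal (n * (pmax * (1 / (M : ℝ)) ^ d)) := by
          rw [← ENNReal.ofReal_mul' (by positivity), ENNReal.ofReal_mul (Nat.cast_nonneg n),
            ENNReal.ofReal_natCast]
      _ ≤ ENNReal.ofReal 2⁻¹ := by
          refine ENNReal.ofReal_le_ofReal ?_
          rw [one_div, inv_pow, ← mul_assoc, ← div_eq_mul_inv, div_le_iff₀ (by positivity)]
          linarith
      _ = 2⁻¹ := by
          rw [ENNReal.ofReal_inv_of_pos two_pos]
          simp
  have h1 := prob_add_prob_compl (μ := Measure.pi (fun _ : Fin n => μ))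
    (measurableSet_avoidCell (n := n) c)
  by_contra! hlt
  have h2 := ENNReal.add_lt_add_of_lt_of_le (by finiteness) hlt hcompl
  rw [h1, ENNReal.inv_two_add_inv_two] at h2
  exact lt_irrefl _ h2

/-- The squared error at the test point `t` for the sample `y` and the label given by
the coordinate `k`. -/
noncomputable def sqError (f : Decoder d n) (g : Cube d → Cube d) (k : Fin d)
    (y : Fin n → Cube d) (t : Cube d) : ℝ≥0∞ :=
  ENNReal.ofReal (((t k : ℝ) - f.1 (fun i => (g (y i), (y i k : ℝ))) (g t)) ^ 2)

theorem measurable_sqError (f : Decoder d n) {g : Cube d → Cube d} (hg : Measurable g)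
    (k : Fin d) : Measurable fun q : (Fin n → Cube d) × Cube d => sqError f g k q.1 q.2 := by
  have h1 : Measurable fun q : (Fin n → Cube d) × Cube d =>
      ((fun i => (g (q.1 i), (q.1 i k : ℝ)), g q.2) : (Fin n → Cube d × ℝ) × Cube d) := by
    refine Measurable.prodMk (measurable_pi_lambda _ fun i => Measurable.prodMk ?_ ?_)
      (hg.comp measurable_snd)
    · exact hg.comp (by fun_prop)
    · fun_prop
  have h2 := f.2.comp h1
  unfold sqError
  refine Measurable.ennreal_ofReal (Measurable.pow_const (Measurable.sub ?_ h2) 2)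
  fun_prop

/-- Only the term `S = {k}` of the average over index sets is kept, which costs the number of index
sets as a factor. -/
theorem lintegral_sqError_le (f : Decoder d n) {g : Cube d → Cube d} (hg : Measurable g)
    (k : Fin d) (μ : Measure (Cube d)) [IsProbabilityMeasure μ] :
    ∫⁻ y, ∫⁻ t, sqError f g k y t ∂μ ∂(Measure.pi fun _ : Fin n => μ) ≤
      Fintype.card (IndexSet d 1) * iclRisk μ g coordTarget f := by
  set S : IndexSet d 1 := ⟨{k}, Finset.card_singleton k⟩ with hS
  have hSk : ∀ x : Cube d, coordTarget (reduce S x) = x k := by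
    intro x
    have h : S.1.orderEmbOfFin S.2 0 = k :=
      Finset.mem_singleton.1 (Finset.orderEmbOfFin_mem S.1 S.2 0)
    simp only [coordTarget, reduce, h]
  have hpos : (Fintype.card (IndexSet d 1) : ℝ≥0∞) ≠ 0 := by
    exact_mod_cast (Fintype.card_pos_iff.2 ⟨S⟩).ne'
  unfold iclRisk
  rw [ENNReal.mul_div_cancel hpos (ENNReal.natCast_ne_top _)]
  refine le_trans (le_of_eq ?_) (Finset.single_le_sum (f := fun S : IndexSet d 1 =>
    ∫⁻ x : Fin (n + 1) → Cube d, ENNReal.ofReal ((coordTarget (reduce S (x (Fin.last n)))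
      - f.1 (fun i : Fin n => (g (x i.castSucc), coordTarget (reduce S (x i.castSucc))))
        (g (x (Fin.last n)))) ^ 2) ∂(Measure.pi (fun _ : Fin (n + 1) => μ)))
    (fun _ _ => zero_le) (Finset.mem_univ S))
  have hm := measurable_sqError f hg k
  have hmp := measurePreserving_piFinSuccAbove (fun _ : Fin (n + 1) => μ) (Fin.last n)
  have hm' : Measurable fun q : Cube d × (Fin n → Cube d) => sqError f g k q.2 q.1 :=
    hm.comp measurable_swap
  have h1 := hmp.lintegral_comp hm'
  have h2 := lintegral_prod_symm' (μ := μ) (ν := Measure.pi fun _ : Fin n => μ) _ hm'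
  rw [← h2]
  refine h1.symm.trans ?_
  refine lintegral_congr fun x => ?_
  simp only [hSk, sqError, MeasurableEquiv.piFinSuccAbove_apply, Fin.insertNthEquiv_symm_apply,
    Fin.removeNth, Fin.succAbove_last]

theorem sum_setLIntegral_cell_le (μ : Measure (Cube d)) (G : Cube d → ℝ≥0∞) :
    ∑ c : Fin d → Fin M, ∫⁻ t in cell c, G t ∂μ ≤ ∫⁻ t, G t ∂μ := by
  have hdisj : Pairwise (Function.onFun Disjoint
      (fun c : Fin d → Fin M => (cell c : Set (Cube d)))) := fun c c' hne =>
    Set.disjoint_left.2 fun x hx hx' => hne (cell_index_unique hx hx')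
  rw [← tsum_fintype (L := .unconditional _), ← lintegral_iUnion measurableSet_cell hdisj]
  exact setLIntegral_le_lintegral _ _

/-- The sign pattern `σ` with the sign of the cell `c` reversed. -/
def flipSign (c : Fin d → Fin M) : Equiv.Perm ((Fin d → Fin M) → Bool) where
  toFun σ := Function.update σ c (!σ c)
  invFun σ := Function.update σ c (!σ c)
  left_inv σ := by simp
  right_inv σ := by simp

theorem flipSign_self (c : Fin d → Fin M) (σ : (Fin d → Fin M) → Bool) :
    flipSign c σ c = !σ c :=
  Function.update_self (β := fun _ => Bool) c (!σ c) σ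

theorem flipSign_of_ne {c c' : Fin d → Fin M} (h : c' ≠ c) (σ : (Fin d → Fin M) → Bool) :
    flipSign c σ c' = σ c' :=
  Function.update_of_ne (β := fun _ => Bool) h (!σ c) σ

/-- When the sample avoids `c`, both encoders produce the same labelled data, hence the same
prediction function on the encoded cube. -/
theorem le_setLIntegral_sqError_add {pmin pmax : ℝ} (hp : 0 < pmin) {μ : Measure (Cube d)}
    (hμ : IsInputLaw pmin pmax μ) (hM : 0 < M) (k : Fin d) {ε : ℝ} (hε0 : 0 ≤ ε)
    (hε : ε ≤ 1 / 2) (f : Decoder d n) (σ : (Fin d → Fin M) → Bool) (c : Fin d → Fin M)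
    {y : Fin n → Cube d} (hy : y ∈ avoidCell c) :
    ENNReal.ofReal (pmin * ((halfSide M / 2) ^ d * (2 * (ε * (halfSide M / 4)) ^ 2))) ≤
      ∫⁻ t in cell c, sqError f (perturb k ε σ) k y t ∂μ +
      ∫⁻ t in cell c, sqError f (perturb k ε (flipSign c σ)) k y t ∂μ := by
  have hsame : ∀ i, perturb k ε (flipSign c σ) (y i) = perturb k ε σ (y i) := by
    intro i
    unfold perturb
    rw [signedBumps_congr fun c' hc' => flipSign_of_ne (fun h => hy i (by rw [← h]; exact hc')) σ]
  have hF : Measurable fun z => f.1 (fun i => (perturb k ε σ (y i), (y i k : ℝ))) z :=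
    f.2.comp measurable_prodMk_left
  have := le_setLIntegral_cell_add hp hμ hM k hε0 hε (flipSign_self c σ) hF
  unfold sqError
  simpa only [hsame] using this

/-- The supremum dominates the average over all sign patterns. Reversing the sign of one cell
permutes the patterns, so each cell contributes the two-point bound on average; the factor `4`
combines this pairing with the probability `1 / 2` of missing the cell. -/
theorem le_iSup_iclRisk {L : ℝ≥0} (hL : 1 < L) {pmin pmax : ℝ} (hp : 0 < pmin)
    {μ : Measure (Cube d)} (hμ : IsInputLaw pmin pmax μ) (hM : 0 < M)
    (hn : 2 * n * pmax ≤ (M : ℝ) ^ d) (k : Fin d) {ε : ℝ} (hε0 : 0 ≤ ε)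
    (hε : ε ≤ (1 - 1 / L) / 2) (f : Decoder d n) :
    (M : ℝ≥0∞) ^ d *
        ENNReal.ofReal (pmin * ((halfSide M / 2) ^ d * (2 * (ε * (halfSide M / 4)) ^ 2))) ≤
      4 * (Fintype.card (IndexSet d 1) *
        ⨆ g ∈ biLipschitzEncoders d L, iclRisk μ g coordTarget f) := by
  have hprob : IsProbabilityMeasure μ := hμ.1
  have hε2 : ε ≤ 1 / 2 := by
    have : 0 < 1 / (L : ℝ) := by
      have : (1 : ℝ) < L := by exact_mod_cast hL
      positivity
    linarith
  set β := ENNReal.ofReal (pmin * ((halfSide M / 2) ^ d * (2 * (ε * (halfSide M / 4)) ^ 2)))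
  set X := (Fintype.card (IndexSet d 1) : ℝ≥0∞) *
    ⨆ g ∈ biLipschitzEncoders d L, iclRisk μ g coordTarget f
  set ν := Measure.pi fun _ : Fin n => μ
  set Ψ : ((Fin d → Fin M) → Bool) → (Fin d → Fin M) → (Fin n → Cube d) → ℝ≥0∞ :=
    fun σ c y => ∫⁻ t in cell c, sqError f (perturb k ε σ) k y t ∂μ with hΨ
  have hgm : ∀ σ : (Fin d → Fin M) → Bool, Measurable (perturb k ε σ : Cube d → Cube d) :=
    fun σ => (continuous_perturb k ε σ).measurable
  have hΨm : ∀ σ c, Measurable (Ψ σ c) := fun σ c =>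
    (measurable_sqError f (hgm σ) k).lintegral_prod_right'
  have hupper : ∀ σ, ∑ c, ∫⁻ y, Ψ σ c y ∂ν ≤ X := by
    intro σ
    calc ∑ c, ∫⁻ y, Ψ σ c y ∂ν = ∫⁻ y, ∑ c, Ψ σ c y ∂ν :=
          (lintegral_finsetSum _ fun c _ => hΨm σ c).symm
      _ ≤ ∫⁻ y, ∫⁻ t, sqError f (perturb k ε σ) k y t ∂μ ∂ν :=
          lintegral_mono fun y => sum_setLIntegral_cell_le μ _
      _ ≤ Fintype.card (IndexSet d 1) * iclRisk μ (perturb k ε σ) coordTarget f :=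
          lintegral_sqError_le f (hgm σ) k μ
      _ ≤ X := by
          refine mul_le_mul_right ?_ _
          exact le_iSup₂ (f := fun g (_ : g ∈ biLipschitzEncoders d L) =>
            iclRisk μ g coordTarget f) _ (perturb_mem_biLipschitzEncoders k hL hε0 hε σ)
  have hpair : ∀ σ c, β * 2⁻¹ ≤ ∫⁻ y, Ψ σ c y ∂ν + ∫⁻ y, Ψ (flipSign c σ) c y ∂ν := by
    intro σ c
    rw [← lintegral_add_left (hΨm σ c)]
    calc β * 2⁻¹ ≤ β * ν (avoidCell c) :=
          mul_le_mul_right (half_le_measure_avoidCell hμ hM hn c) _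
      _ = ∫⁻ y in avoidCell c, β ∂ν := (setLIntegral_const _ _).symm
      _ ≤ ∫⁻ y in avoidCell c, (Ψ σ c y + Ψ (flipSign c σ) c y) ∂ν :=
          setLIntegral_mono' (measurableSet_avoidCell c) fun y hy =>
            le_setLIntegral_sqError_add hp hμ hM k hε0 hε2 f σ c hy
      _ ≤ _ := setLIntegral_le_lintegral _ _
  set K : ℝ≥0∞ := (Fintype.card ((Fin d → Fin M) → Bool) : ℝ≥0∞) with hK
  have hK0 : K ≠ 0 := by
    rw [hK]
    exact_mod_cast (Fintype.card_pos (α := (Fin d → Fin M) → Bool)).ne'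
  have hN : ((Fintype.card (Fin d → Fin M) : ℕ) : ℝ≥0∞) = (M : ℝ≥0∞) ^ d := by
    simp
  have hflip : ∀ c, ∑ σ, ∫⁻ y, Ψ (flipSign c σ) c y ∂ν = ∑ σ, ∫⁻ y, Ψ σ c y ∂ν := fun c =>
    Equiv.sum_comp (flipSign c) fun σ => ∫⁻ y, Ψ σ c y ∂ν
  have hmain : K * ((M : ℝ≥0∞) ^ d * (β * 2⁻¹)) ≤ K * (2 * X) := by
    calc K * ((M : ℝ≥0∞) ^ d * (β * 2⁻¹))
        = ∑ c : Fin d → Fin M, ∑ _σ : (Fin d → Fin M) → Bool, β * 2⁻¹ := by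
          rw [Finset.sum_const, Finset.sum_const, nsmul_eq_mul, nsmul_eq_mul, Finset.card_univ,
            Finset.card_univ, hN]
          ring
      _ ≤ ∑ c, ∑ σ, (∫⁻ y, Ψ σ c y ∂ν + ∫⁻ y, Ψ (flipSign c σ) c y ∂ν) :=
          Finset.sum_le_sum fun c _ => Finset.sum_le_sum fun σ _ => hpair σ c
      _ = 2 * ∑ σ, ∑ c, ∫⁻ y, Ψ σ c y ∂ν := by
          rw [Finset.sum_comm (s := Finset.univ) (t := Finset.univ)
            (f := fun σ c => ∫⁻ y, Ψ σ c y ∂ν), Finset.mul_sum]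
          refine Finset.sum_congr rfl fun c _ => ?_
          rw [Finset.sum_add_distrib, hflip, two_mul]
      _ ≤ 2 * ∑ _σ : (Fin d → Fin M) → Bool, X :=
          mul_le_mul_right (Finset.sum_le_sum fun σ _ => hupper σ) _
      _ = K * (2 * X) := by
          rw [Finset.sum_const, nsmul_eq_mul, Finset.card_univ]
          ring
  have hcancel := (ENNReal.mul_le_mul_iff_right hK0 (ENNReal.natCast_ne_top _)).1 hmain
  calc (M : ℝ≥0∞) ^ d * β = 2 * ((M : ℝ≥0∞) ^ d * (β * 2⁻¹)) := by
        rw [mul_comm β, mul_left_comm _ (2⁻¹ : ℝ≥0∞), ← mul_assoc 2,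
          ENNReal.mul_inv_cancel two_ne_zero ENNReal.ofNat_ne_top, one_mul]
    _ ≤ 2 * (2 * X) := mul_le_mul_right hcancel _
    _ = 4 * X := by
        rw [← mul_assoc]
        norm_num

theorem exists_le_encoderMinimaxRisk (d : ℕ) (hd : 1 ≤ d) {L : ℝ≥0} (hL : 1 < L)
    {pmin : ℝ} (pmax : ℝ) (hp : 0 < pmin) :
    ∃ c : ℝ, 0 < c ∧ ∀ μ : Measure (Cube d), IsInputLaw pmin pmax μ → ∀ n : ℕ, 1 ≤ n →
      ENNReal.ofReal (c * (n : ℝ) ^ (-(2 : ℝ) / (d : ℝ))) ≤ encoderMinimaxRisk n L μ := by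
  have hL' : (1 : ℝ) < L := by exact_mod_cast hL
  have hd0 : (0 : ℝ) < d := by exact_mod_cast hd
  set k : Fin d := ⟨0, hd⟩
  set ε : ℝ := (1 - 1 / L) / 2 with hε
  have hε0 : 0 < ε := by
    have : 1 / (L : ℝ) < 1 := by rw [div_lt_one (by linarith)]; exact hL'
    linarith
  -- With `M = K * ⌈n ^ (1/d)⌉`, the choice `K ≥ max 1 (2 * pmax)` gives `2 * n * pmax ≤ M ^ d`,
  -- while `M` is still at most `2 * K * n ^ (1/d)`.
  obtain ⟨K, hK⟩ := exists_nat_ge (max 1 (2 * pmax))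
  have hK1 : (1 : ℝ) ≤ K := (le_max_left _ _).trans hK
  have hK2 : 2 * pmax ≤ K := (le_max_right _ _).trans hK
  set q := Fintype.card (IndexSet d 1) with hq
  have hq0 : 0 < q := Fintype.card_pos_iff.2 ⟨⟨{k}, Finset.card_singleton k⟩⟩
  have hq0' : (0 : ℝ) < q := by exact_mod_cast hq0
  refine ⟨pmin * (1 / 4) ^ d * ε ^ 2 / (512 * q * K ^ 2), by positivity, fun μ hμ n hn => ?_⟩
  have hn' : (1 : ℝ) ≤ n := by exact_mod_cast hn
  set a : ℝ := (n : ℝ) ^ (1 / (d : ℝ)) with ha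
  have ha1 : 1 ≤ a := Real.one_le_rpow hn' (by positivity)
  have had : a ^ d = n := by
    rw [ha, ← Real.rpow_natCast, ← Real.rpow_mul (by positivity), one_div_mul_cancel hd0.ne',
      Real.rpow_one]
  have ha2 : (n : ℝ) ^ (-(2 : ℝ) / (d : ℝ)) = (a ^ 2)⁻¹ := by
    rw [ha, ← Real.rpow_natCast, ← Real.rpow_mul (by positivity), ← Real.rpow_neg (by positivity)]
    congr 1
    push_cast
    ring
  set M := K * ⌈a⌉₊ with hM
  have hMa : (K : ℝ) * a ≤ M := by
    rw [hM]
    push_cast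
    gcongr
    exact Nat.le_ceil a
  have hMa2 : (M : ℝ) ≤ 2 * K * a := by
    rw [hM]
    push_cast
    have := (Nat.ceil_lt_add_one (zero_le_one.trans ha1)).le
    nlinarith
  have hM0' : (0 : ℝ) < M := by nlinarith
  have hM0 : 0 < M := by exact_mod_cast hM0'
  have hcond : 2 * n * pmax ≤ (M : ℝ) ^ d := by
    calc 2 * n * pmax = (2 * pmax) * n := by ring
      _ ≤ K * n := by gcongr
      _ ≤ (K : ℝ) ^ d * a ^ d := by
          rw [had]
          gcongr
          exact le_self_pow₀ hK1 (by omega)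
      _ = (K * a) ^ d := (mul_pow _ _ _).symm
      _ ≤ (M : ℝ) ^ d := by gcongr
  refine le_iInf fun f => ?_
  have h := le_iSup_iclRisk hL hp hμ hM0 hcond k hε0.le le_rfl f
  rw [← ENNReal.ofReal_natCast, ← ENNReal.ofReal_pow hM0'.le,
    ← ENNReal.ofReal_mul (by positivity), ← mul_assoc (4 : ℝ≥0∞)] at h
  have h4 : (4 : ℝ≥0∞) * q = ENNReal.ofReal (4 * q) := by
    rw [ENNReal.ofReal_mul (by norm_num), ENNReal.ofReal_natCast]
    norm_num
  rw [← hq, h4, mul_comm (ENNReal.ofReal (4 * (q : ℝ))), ← ENNReal.div_le_iff_le_mul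
    (Or.inl (by simpa using hq0.ne')) (Or.inl ENNReal.ofReal_ne_top),
    ← ENNReal.ofReal_div_of_pos (by positivity)] at h
  refine le_trans (ENNReal.ofReal_le_ofReal ?_) h
  -- The number of cells cancels their volume: `M * (halfSide M / 2) = 1 / 4`, leaving `M ^ (-2)`
  -- from the squared displacement.
  have e : (M : ℝ) ^ d * (pmin * ((halfSide M / 2) ^ d * (2 * (ε * (halfSide M / 4)) ^ 2))) /
      (4 * q) = pmin * (1 / 4) ^ d * ε ^ 2 / (128 * q * (M : ℝ) ^ 2) := by
    have e1 : (M : ℝ) ^ d * (halfSide M / 2) ^ d = (1 / 4) ^ d := by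
      rw [← mul_pow]
      congr 1
      unfold halfSide
      field_simp
      norm_num
    have e2 : (ε * (halfSide M / 4)) ^ 2 = ε ^ 2 / (64 * (M : ℝ) ^ 2) := by
      unfold halfSide
      field_simp
      norm_num
    calc _ = pmin * ((M : ℝ) ^ d * (halfSide M / 2) ^ d) * 2 * (ε * (halfSide M / 4)) ^ 2 /
          (4 * q) := by ring
      _ = _ := by
        rw [e1, e2]
        field_simp
        norm_num
  rw [e, ha2, ← div_eq_mul_inv, div_div]
  refine div_le_div_of_nonneg_left (by positivity) (by positivity) ?_
  have : (M : ℝ) ^ 2 ≤ (2 * K * a) ^ 2 := by gcongr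
  calc 128 * q * (M : ℝ) ^ 2 ≤ 128 * q * (2 * K * a) ^ 2 := by gcongr
    _ = _ := by ring

end lower

/-! ### Both statements combined -/

theorem proposition3 :
    (∀ d κ : ℕ, 1 ≤ κ → κ ≤ d →
      ∃ f : (n : ℕ) → Decoder d n,
        ∀ pmin pmax : ℝ, 0 < pmin →
          ∃ C : ℝ, 0 < C ∧
            ∀ μ : Measure (Cube d), IsInputLaw pmin pmax μ →
              ∀ (L : ℝ≥0) (n : ℕ), 1 ≤ n →
                (⨆ π ∈ lipschitzTargets κ L, iclRisk μ id π (f n)) ≤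
                  ENNReal.ofReal (C * (L : ℝ) ^ 2 * (n : ℝ) ^ (-(2 : ℝ) / (κ : ℝ)))) ∧
    (∀ d : ℕ, 1 ≤ d →
      ∀ L : ℝ≥0, 1 < L →
        ∀ pmin pmax : ℝ, 0 < pmin →
          ∃ c C : ℝ, 0 < c ∧ 0 < C ∧
            ∀ μ : Measure (Cube d), IsInputLaw pmin pmax μ →
              ∀ n : ℕ, 1 ≤ n →
                ENNReal.ofReal (c * (n : ℝ) ^ (-(2 : ℝ) / (d : ℝ))) ≤
                    encoderMinimaxRisk n L μ ∧
                encoderMinimaxRisk n L μ ≤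
                    ENNReal.ofReal (C * (n : ℝ) ^ (-(2 : ℝ) / (d : ℝ)))) := by
  refine ⟨exists_decoder_adapting_to_coordinates, fun d hd L hL pmin pmax hp => ?_⟩
  obtain ⟨c, hc, hlow⟩ := exists_le_encoderMinimaxRisk d hd hL pmax hp
  refine ⟨c, 4 * (L : ℝ) ^ 4 * d * nnConst pmin d, hc, ?_, fun μ hμ n hn =>
    ⟨hlow μ hμ n hn, encoderMinimaxRisk_le d hd hL hp hμ hn⟩⟩
  have h1 := one_le_nnConst hp d
  have h2 : (0 : ℝ) < L := zero_lt_one.trans (by exact_mod_cast hL)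
  have h3 : (0 : ℝ) < d := by exact_mod_cast hd
  positivity
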